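/- **The theory $\mathsf{DH}$.** There are three sorts: $G$ (group elements), $E$ (exponents) and $NZE$ (non-zero exponents), with $NZE$ a subsort of $E$. The operations are $\cdot: G\times G\to G$, $\mathrm{id}:G$, $\mathrm{inv}:G\to G$, $\exp: G\times E\to G$ (written $a^e$), $\boxtimes: G\to NZE$, $+,*:E\times E\to E$, $0:E$, $-:E\to E$, $1: NZE$, $i: NZE\to NZE$ and $**: NZE\times NZE\to NZE$. Terms are well-sorted terms over given sets of variables of each sort. The equations of $\mathsf{DH}$ say that * $(G,\cdot,\mathrm{inv},\mathrm{id})$ is an abelian group: $(a\cdot b)\cdot c=a\cdot(b\cdot c)$, $a\cdot b=b\cdot a$, $b\cdot \mathrm{id}=b$, $b\cdot\mathrm{inv}(b)=\mathrm{id}$; * $(E,+,0,-,*,1)$ is a commutative unitary ring: $(x+y)+z=x+(y+z)$, $x+y=y+x$, $x+0=x$, $x+(-x)=0$, $(x*y)*z=x*(y*z)$, $x*y=y*x$, $x*(y+z)=(x*y)+(x*z)$, $x*1=x$; * for $u,v,w$ of sort $NZE$: $u**v=u*v$, $u*i(u)=1$, $i(u**v)=i(u)**i(v)$, $i(1)=1$,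 $i(i(w))=w$; * exponentiation makes $G$ a unitary right $E$-module: $(a^x)^y=a^{x*y}$, $a^1=a$, $(a\cdot b)^x=a^x\cdot b^x$, $a^{x+y}=a^x\cdot a^y$, $\mathrm{id}^x=\mathrm{id}$. $\mathsf{DH}\vdash s=t$ means that $s=t$ is derivable from these equations in order-sorted equational logic. **Reduction.** The rewrite rules are all the equations above except associativity and commutativity of $\cdot,+,*$, read from left to right, together with $\mathrm{inv}(\mathrm{id})\to\mathrm{id}$, $\mathrm{inv}(a\cdot b)\to\mathrm{inv}(a)\cdot\mathrm{inv}(b)$, $\mathrm{inv}(\mathrm{inv}(b))\to b$, $(\mathrm{inv}(a))^x\to\mathrm{inv}(a^x)$, $a^0\to\mathrm{id}$, $a^{-x}\to\mathrm{inv}(a^x)$, $-0\to0$, $-(x+y)\to(-x)+(-y)$, $-(-x)\to x$, $0*x\to0$, $(-x)*y\to-(x*y)$. Reduction is rewriting (at positions where the result is well-sorted) with these rules modulo associativity and commutativity of $\cdot,+,*$. A term is irreducible if no rewrite step modulo associativity and commutativity applies to it. **Models.** For a field $F$, $\mathcal M_F$ interprets $G$ and $E$ as $F$ and $NZE$ as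 $F\setminus\{0\}$; the operations of $E$ and $NZE$ are those of $F$ ($i$ is multiplicative inverse, $**$ is multiplication), $\cdot,\mathrm{id},\mathrm{inv}$ are $+,0,-$ of $F$, and $a^e$ is $a*e$. A box function on $\mathcal M_F$ is an arbitrary function $F\to F\setminus\{0\}$, interpreting $\boxtimes$. For a non-principal ultrafilter $D$ on the set of primes, $\mathcal M_D=\mathcal M_{\mathbb F_D}$, where $\mathbb F_D=\prod_D\mathbb F_q$ is the ultraproduct of the prime fields. $\mathcal M\models s=t$ means that $s$ and $t$ have the same value in $\mathcal M$ under every sort-respecting assignment of the variables. **Theorem (full language).** For all terms $s,t$ of sort $G$ the following are equivalent: 1. $\mathsf{DH}\vdash s=t$; 2. for all primes $q$ and all box functions on $\mathcal M_{\mathbb F_q}$, $\mathcal M_{\mathbb F_q}\models s=t$; 3. for all non-principal $D$ and all box functions on $\mathcal M_D$, $\mathcal M_D\models s=t$; 4. for some non-principal $D$ and all box functions on $\mathcal M_D$, $\mathcal M_D\models s=t$; 5. for all box functions on $\mathcal M_{\mathbb Q}$, $\mathcal M_{\mathbb Q}\models s=t$; 6. if $s$ reduces to an irreducible $s'$ and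 $t$ reduces to an irreducible $t'$, then $s'$ and $t'$ are identical modulo associativity and commutativity of $\cdot$, $+$ and $*$. **Theorem ($\boxtimes$-free language).** For all $\boxtimes$-free terms $s,t$ of sort $G$ the following are equivalent: 1. $\mathsf{DH}\vdash s=t$ (equivalently, $s=t$ has a derivation in which only $\boxtimes$-free terms occur); 2. for all primes $q$, $\mathcal M_{\mathbb F_q}\models s=t$; 3. for all non-principal $D$, $\mathcal M_D\models s=t$; 4. for some non-principal $D$, $\mathcal M_D\models s=t$; 5. $\mathcal M_{\mathbb Q}\models s=t$; 6. the same statement on irreducible reducts as in 6 above. -/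

import Mathlib

/-- The three sorts of the signature; `NZE` (non-zero exponents) is a subsort of `E` (exponents),
and `G` is the sort of base-group elements. -/
inductive DHSort where
  | G
  | E
  | NZE

/-- The full language, and the language with the function `box` removed from the signature. -/
inductive DHLang where
  | full
  | boxFree

/-- Whether `box` belongs to the signature. -/
def DHLang.HasBox : DHLang → Prop
  | .full => True
  | .boxFree => False

/-- Well-sorted terms over a sorted family `X` of variables.  The constructor `incl` is the subsort
inclusion of `NZE` in `E`, `nmul` is the operation `**` on `NZE` and `ninv` is the operation `i`. -/
inductive DHTerm (L : DHLang) (X : DHSort → Type*) : DHSort → Type _ where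
  | var {σ : DHSort} (x : X σ) : DHTerm L X σ
  | gop (a b : DHTerm L X .G) : DHTerm L X .G
  | gid : DHTerm L X .G
  | ginv (a : DHTerm L X .G) : DHTerm L X .G
  | exp (a : DHTerm L X .G) (x : DHTerm L X .E) : DHTerm L X .G
  | box (h : L.HasBox) (a : DHTerm L X .G) : DHTerm L X .NZE
  | add (x y : DHTerm L X .E) : DHTerm L X .E
  | zero : DHTerm L X .E
  | neg (x : DHTerm L X .E) : DHTerm L X .E
  | mul (x y : DHTerm L X .E) : DHTerm L X .E
  | incl (u : DHTerm L X .NZE) : DHTerm L X .E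
  | one : DHTerm L X .NZE
  | ninv (u : DHTerm L X .NZE) : DHTerm L X .NZE
  | nmul (u v : DHTerm L X .NZE) : DHTerm L X .NZE

namespace DHTerm

/-- A box-free term, viewed as a term of the full language. -/
def toFull {X : DHSort → Type*} : {σ : DHSort} → DHTerm .boxFree X σ → DHTerm .full X σ
  | _, var x => var x
  | _, gop a b => gop a.toFull b.toFull
  | _, gid => gid
  | _, ginv a => ginv a.toFull
  | _, exp a x => exp a.toFull x.toFull
  | _, box h _ => False.elim h
  | _, add x y => add x.toFull y.toFull
  | _, zero => zero
  | _, neg x => neg x.toFull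
  | _, mul x y => mul x.toFull y.toFull
  | _, incl u => incl u.toFull
  | _, one => one
  | _, ninv u => ninv u.toFull
  | _, nmul u v => nmul u.toFull v.toFull

section Relations

variable {L : DHLang} {X : DHSort → Type*}

/-- Instances of associativity and commutativity of the group operation, of `+` and of `*`. -/
inductive ACAx : {σ : DHSort} → DHTerm L X σ → DHTerm L X σ → Prop where
  | gop_assoc (a b c : DHTerm L X .G) : ACAx (gop (gop a b) c) (gop a (gop b c))
  | gop_comm (a b : DHTerm L X .G) : ACAx (gop a b) (gop b a)
  | add_assoc (x y z : DHTerm L X .E) : ACAx (add (add x y) z) (add x (add y z))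
  | add_comm (x y : DHTerm L X .E) : ACAx (add x y) (add y x)
  | mul_assoc (x y z : DHTerm L X .E) : ACAx (mul (mul x y) z) (mul x (mul y z))
  | mul_comm (x y : DHTerm L X .E) : ACAx (mul x y) (mul y x)

/-- Instances of the equations of the theory other than associativity and commutativity, each
written so that as a rewrite rule it is read from left to right. -/
inductive BaseRule : {σ : DHSort} → DHTerm L X σ → DHTerm L X σ → Prop where
  -- the group
  | gop_gid (b : DHTerm L X .G) : BaseRule (gop b gid) b
  | gop_ginv (b : DHTerm L X .G) : BaseRule (gop b (ginv b)) gid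
  -- the ring of exponents
  | add_zero (x : DHTerm L X .E) : BaseRule (add x zero) x
  | add_neg (x : DHTerm L X .E) : BaseRule (add x (neg x)) zero
  | mul_add (x y z : DHTerm L X .E) : BaseRule (mul x (add y z)) (add (mul x y) (mul x z))
  | mul_one (x : DHTerm L X .E) : BaseRule (mul x (incl one)) x
  -- multiplicative inverse, and closure of the non-zero exponents under multiplication
  | nmul_eq (u v : DHTerm L X .NZE) : BaseRule (incl (nmul u v)) (mul (incl u) (incl v))
  | mul_ninv (u : DHTerm L X .NZE) : BaseRule (mul (incl u) (incl (ninv u))) (incl one)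
  | ninv_nmul (u v : DHTerm L X .NZE) : BaseRule (ninv (nmul u v)) (nmul (ninv u) (ninv v))
  | ninv_one : BaseRule (ninv one) one
  | ninv_ninv (w : DHTerm L X .NZE) : BaseRule (ninv (ninv w)) w
  -- exponentiation
  | exp_exp (a : DHTerm L X .G) (x y : DHTerm L X .E) :
      BaseRule (exp (exp a x) y) (exp a (mul x y))
  | exp_one (a : DHTerm L X .G) : BaseRule (exp a (incl one)) a
  | gop_exp (a b : DHTerm L X .G) (x : DHTerm L X .E) :
      BaseRule (exp (gop a b) x) (gop (exp a x) (exp b x))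
  | exp_add (a : DHTerm L X .G) (x y : DHTerm L X .E) :
      BaseRule (exp a (add x y)) (gop (exp a x) (exp a y))
  | gid_exp (x : DHTerm L X .E) : BaseRule (exp gid x) gid

/-- Instances of the rewrite rules that are added to the oriented equations. -/
inductive ExtraRule : {σ : DHSort} → DHTerm L X σ → DHTerm L X σ → Prop where
  | ginv_gid : ExtraRule (ginv gid) gid
  | ginv_gop (a b : DHTerm L X .G) : ExtraRule (ginv (gop a b)) (gop (ginv a) (ginv b))
  | ginv_ginv (b : DHTerm L X .G) : ExtraRule (ginv (ginv b)) b
  | ginv_exp (a : DHTerm L X .G) (x : DHTerm L X .E) :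
      ExtraRule (exp (ginv a) x) (ginv (exp a x))
  | exp_zero (a : DHTerm L X .G) : ExtraRule (exp a zero) gid
  | exp_neg (a : DHTerm L X .G) (x : DHTerm L X .E) :
      ExtraRule (exp a (neg x)) (ginv (exp a x))
  | neg_zero : ExtraRule (neg zero) zero
  | neg_add (x y : DHTerm L X .E) : ExtraRule (neg (add x y)) (add (neg x) (neg y))
  | neg_neg (x : DHTerm L X .E) : ExtraRule (neg (neg x)) x
  | zero_mul (x : DHTerm L X .E) : ExtraRule (mul zero x) zero
  | neg_mul (x y : DHTerm L X .E) : ExtraRule (mul (neg x) y) (neg (mul x y))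

/-- The equations of the theory `DH` (all substitution instances). -/
def TheoryAx {σ : DHSort} (s t : DHTerm L X σ) : Prop := ACAx s t ∨ BaseRule s t

/-- The rewrite rules of the system (all substitution instances). -/
def RewriteRule {σ : DHSort} (s t : DHTerm L X σ) : Prop := BaseRule s t ∨ ExtraRule s t

/-- `DH ⊢ s = t`: derivability in (order-sorted) equational logic.  Since `NZE` is a subsort of `E`,
an equation between terms of sort `NZE` is the same thing as that equation read at sort `E`; this is
the content of `incl` and `of_incl`. -/
inductive Provable : {σ : DHSort} → DHTerm L X σ → DHTerm L X σ → Prop where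
  | ax {σ : DHSort} {s t : DHTerm L X σ} : TheoryAx s t → Provable s t
  | refl {σ : DHSort} (s : DHTerm L X σ) : Provable s s
  | symm {σ : DHSort} {s t : DHTerm L X σ} : Provable s t → Provable t s
  | trans {σ : DHSort} {s t r : DHTerm L X σ} : Provable s t → Provable t r → Provable s r
  | gop {a a' b b' : DHTerm L X .G} :
      Provable a a' → Provable b b' → Provable (gop a b) (gop a' b')
  | ginv {a a' : DHTerm L X .G} : Provable a a' → Provable (ginv a) (ginv a')
  | exp {a a' : DHTerm L X .G} {x x' : DHTerm L X .E} :
      Provable a a' → Provable x x' → Provable (exp a x) (exp a' x')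
  | box (h : L.HasBox) {a a' : DHTerm L X .G} : Provable a a' → Provable (box h a) (box h a')
  | add {x x' y y' : DHTerm L X .E} :
      Provable x x' → Provable y y' → Provable (add x y) (add x' y')
  | neg {x x' : DHTerm L X .E} : Provable x x' → Provable (neg x) (neg x')
  | mul {x x' y y' : DHTerm L X .E} :
      Provable x x' → Provable y y' → Provable (mul x y) (mul x' y')
  | incl {u u' : DHTerm L X .NZE} : Provable u u' → Provable (incl u) (incl u')
  | of_incl {u u' : DHTerm L X .NZE} : Provable (incl u) (incl u') → Provable u u'
  | ninv {u u' : DHTerm L X .NZE} : Provable u u' → Provable (ninv u) (ninv u')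
  | nmul {u u' v v' : DHTerm L X .NZE} :
      Provable u u' → Provable v v' → Provable (nmul u v) (nmul u' v')

/-- Replacement of one subterm according to `R`. -/
inductive StepIn (R : ∀ {σ : DHSort}, DHTerm L X σ → DHTerm L X σ → Prop) :
    {σ : DHSort} → DHTerm L X σ → DHTerm L X σ → Prop where
  | root {σ : DHSort} {s t : DHTerm L X σ} : R s t → StepIn R s t
  | gop_left {a a' : DHTerm L X .G} (b : DHTerm L X .G) :
      StepIn R a a' → StepIn R (gop a b) (gop a' b)
  | gop_right (a : DHTerm L X .G) {b b' : DHTerm L X .G} :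
      StepIn R b b' → StepIn R (gop a b) (gop a b')
  | ginv {a a' : DHTerm L X .G} : StepIn R a a' → StepIn R (ginv a) (ginv a')
  | exp_left {a a' : DHTerm L X .G} (x : DHTerm L X .E) :
      StepIn R a a' → StepIn R (exp a x) (exp a' x)
  | exp_right (a : DHTerm L X .G) {x x' : DHTerm L X .E} :
      StepIn R x x' → StepIn R (exp a x) (exp a x')
  | box (h : L.HasBox) {a a' : DHTerm L X .G} : StepIn R a a' → StepIn R (box h a) (box h a')
  | add_left {x x' : DHTerm L X .E} (y : DHTerm L X .E) :
      StepIn R x x' → StepIn R (add x y) (add x' y)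
  | add_right (x : DHTerm L X .E) {y y' : DHTerm L X .E} :
      StepIn R y y' → StepIn R (add x y) (add x y')
  | neg {x x' : DHTerm L X .E} : StepIn R x x' → StepIn R (neg x) (neg x')
  | mul_left {x x' : DHTerm L X .E} (y : DHTerm L X .E) :
      StepIn R x x' → StepIn R (mul x y) (mul x' y)
  | mul_right (x : DHTerm L X .E) {y y' : DHTerm L X .E} :
      StepIn R y y' → StepIn R (mul x y) (mul x y')
  | incl {u u' : DHTerm L X .NZE} : StepIn R u u' → StepIn R (incl u) (incl u')
  | ninv {u u' : DHTerm L X .NZE} : StepIn R u u' → StepIn R (ninv u) (ninv u')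
  | nmul_left {u u' : DHTerm L X .NZE} (v : DHTerm L X .NZE) :
      StepIn R u u' → StepIn R (nmul u v) (nmul u' v)
  | nmul_right (u : DHTerm L X .NZE) {v v' : DHTerm L X .NZE} :
      StepIn R v v' → StepIn R (nmul u v) (nmul u v')

/-- Two terms are identical modulo associativity and commutativity of the group operation, `+` and
`*`. -/
def ACEquiv {σ : DHSort} (s t : DHTerm L X σ) : Prop :=
  Relation.EqvGen (StepIn (fun {_} a b => ACAx a b)) s t

/-- One rewrite step modulo associativity and commutativity. -/
def Rewrites {σ : DHSort} (s t : DHTerm L X σ) : Prop :=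
  ∃ s' t' : DHTerm L X σ,
    ACEquiv s s' ∧ StepIn (fun {_} a b => RewriteRule a b) s' t' ∧ ACEquiv t' t

/-- `s` reduces to `t` in finitely many (possibly zero) rewrite steps. -/
def Reduces {σ : DHSort} (s t : DHTerm L X σ) : Prop :=
  Relation.ReflTransGen (fun a b : DHTerm L X σ => Rewrites a b) s t

/-- Normal forms: no rewrite step modulo associativity and commutativity applies. -/
def IsIrreducible {σ : DHSort} (s : DHTerm L X σ) : Prop := ∀ t : DHTerm L X σ, ¬ Rewrites s t

/-- The normal forms of `s` and `t` coincide modulo associativity and commutativity. -/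
def SameNormalForm {σ : DHSort} (s t : DHTerm L X σ) : Prop :=
  ∀ s' t' : DHTerm L X σ, Reduces s s' → IsIrreducible s' → Reduces t t' → IsIrreducible t' →
    ACEquiv s' t'

end Relations

end DHTerm

/-- Structures for the signature: a carrier for each sort and an interpretation of each symbol. -/
structure DHStructure (L : DHLang) where
  carrier : DHSort → Type
  gop : carrier .G → carrier .G → carrier .G
  gid : carrier .G
  ginv : carrier .G → carrier .G
  exp : carrier .G → carrier .E → carrier .G
  box : L.HasBox → carrier .G → carrier .NZE
  add : carrier .E → carrier .E → carrier .E
  zero : carrier .E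
  neg : carrier .E → carrier .E
  mul : carrier .E → carrier .E → carrier .E
  incl : carrier .NZE → carrier .E
  one : carrier .NZE
  ninv : carrier .NZE → carrier .NZE
  nmul : carrier .NZE → carrier .NZE → carrier .NZE

namespace DHStructure

/-- The value of a term under an environment. -/
def eval {L : DHLang} {X : DHSort → Type*} (M : DHStructure L) (η : ∀ σ, X σ → M.carrier σ) :
    {σ : DHSort} → DHTerm L X σ → M.carrier σ
  | _, .var x => η _ x
  | _, .gop a b => M.gop (M.eval η a) (M.eval η b)
  | _, .gid => M.gid
  | _, .ginv a => M.ginv (M.eval η a)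
  | _, .exp a x => M.exp (M.eval η a) (M.eval η x)
  | _, .box h a => M.box h (M.eval η a)
  | _, .add x y => M.add (M.eval η x) (M.eval η y)
  | _, .zero => M.zero
  | _, .neg x => M.neg (M.eval η x)
  | _, .mul x y => M.mul (M.eval η x) (M.eval η y)
  | _, .incl u => M.incl (M.eval η u)
  | _, .one => M.one
  | _, .ninv u => M.ninv (M.eval η u)
  | _, .nmul u v => M.nmul (M.eval η u) (M.eval η v)

/-- `M ⊨ s = t`: the equation holds in `M` under every environment. -/
def Satisfies {L : DHLang} {X : DHSort → Type*} (M : DHStructure L) {σ : DHSort}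
    (s t : DHTerm L X σ) : Prop :=
  ∀ η : ∀ σ, X σ → M.carrier σ, M.eval η s = M.eval η t

/-- The carriers of the structure of a field `F`: `G` and `E` are `F`, and `NZE` is the set of
non-zero elements of `F` (its units). -/
abbrev fieldCarrier (F : Type) [Field F] : DHSort → Type
  | .G => F
  | .E => F
  | .NZE => Fˣ

/-- The structure of a field `F`, in either language: the group operation is addition and
exponentiation is multiplication. -/
abbrev ofField (L : DHLang) (F : Type) [Field F] (b : L.HasBox → F → Fˣ) : DHStructure L where
  carrier := fieldCarrier F
  gop := fun a c : F => (a + c : F)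
  gid := (0 : F)
  ginv := fun a : F => -a
  exp := fun a x : F => a * x
  box := b
  add := fun x y : F => x + y
  zero := (0 : F)
  neg := fun x : F => -x
  mul := fun x y : F => x * y
  incl := fun u : Fˣ => (u : F)
  one := (1 : Fˣ)
  ninv := fun u : Fˣ => (u⁻¹ : Fˣ)
  nmul := fun u v : Fˣ => (u * v : Fˣ)

/-- The structure `M_F` for the full language, with the box function `b`. -/
abbrev withBox (F : Type) [Field F] (b : F → Fˣ) : DHStructure .full := ofField .full F fun _ => b

/-- The structure `M_F` for the language without `box`. -/
abbrev withoutBox (F : Type) [Field F] : DHStructure .boxFree := ofField .boxFree F fun h => h.elim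

end DHStructure

/-- An ultrafilter over the set of primes is non-principal. -/
def NonPrincipal (D : Ultrafilter Nat.Primes) : Prop := ∀ q : Nat.Primes, D ≠ pure q

/-- Equality of families `D`-almost everywhere, a congruence of the product ring of all `𝔽_q`. -/
def primeUltraCon (D : Ultrafilter Nat.Primes) : RingCon (∀ q : Nat.Primes, ZMod q) where
  r f g := ∀ᶠ q in (D : Filter Nat.Primes), f q = g q
  iseqv :=
    ⟨fun _ => Filter.Eventually.of_forall fun _ => rfl,
      fun h => h.mono fun _ hq => hq.symm,
      fun h k => (h.and k).mono fun _ hq => hq.1.trans hq.2⟩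
  add' h k := (h.and k).mono fun _ hq => congrArg₂ (· + ·) hq.1 hq.2
  mul' h k := (h.and k).mono fun _ hq => congrArg₂ (· * ·) hq.1 hq.2

/-- The ultraproduct of the prime fields `𝔽_q` modulo `D`. -/
abbrev PrimeUltraproduct (D : Ultrafilter Nat.Primes) : Type := (primeUltraCon D).Quotient

theorem PrimeUltraproduct.coe_eq_coe (D : Ultrafilter Nat.Primes)
    (f g : ∀ q : Nat.Primes, ZMod q) :
    (f : PrimeUltraproduct D) = (g : PrimeUltraproduct D) ↔
      ∀ᶠ q in (D : Filter Nat.Primes), f q = g q :=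
  (primeUltraCon D).eq

instance PrimeUltraproduct.instNontrivial (D : Ultrafilter Nat.Primes) :
    Nontrivial (PrimeUltraproduct D) := by
  refine ⟨⟨((0 : ∀ q : Nat.Primes, ZMod q) : PrimeUltraproduct D),
    ((1 : ∀ q : Nat.Primes, ZMod q) : PrimeUltraproduct D), fun h => ?_⟩⟩
  obtain ⟨q, hq⟩ := ((PrimeUltraproduct.coe_eq_coe D _ _).1 h).exists
  have : Fact (q : ℕ).Prime := ⟨q.2⟩
  exact zero_ne_one hq

theorem PrimeUltraproduct.isUnit_or_eq_zero (D : Ultrafilter Nat.Primes)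
    (a : PrimeUltraproduct D) : IsUnit a ∨ a = 0 := by
  obtain ⟨f, rfl⟩ := Quotient.exists_rep a
  by_cases h : ∀ᶠ q in (D : Filter Nat.Primes), f q = 0
  · exact Or.inr ((PrimeUltraproduct.coe_eq_coe D f 0).2 h)
  · left
    have h' : ∀ᶠ q in (D : Filter Nat.Primes), f q ≠ 0 := Ultrafilter.eventually_not.2 h
    refine IsUnit.of_mul_eq_one
      ((fun q => (f q)⁻¹ : ∀ q : Nat.Primes, ZMod q) : PrimeUltraproduct D) ?_
    refine (PrimeUltraproduct.coe_eq_coe D (f * fun q => (f q)⁻¹) 1).2 (h'.mono fun q hq => ?_)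
    have : Fact (q : ℕ).Prime := ⟨q.2⟩
    exact mul_inv_cancel₀ hq

noncomputable instance PrimeUltraproduct.instField (D : Ultrafilter Nat.Primes) :
    Field (PrimeUltraproduct D) :=
  Field.ofIsUnitOrEqZero (PrimeUltraproduct.isUnit_or_eq_zero D)

/-!
Derivability implies validity in every field, for every box function, by induction on derivations.
Conversely, all the remaining conditions are led through normal forms.

*Normal forms exist.*  A polynomial interpretation in the natural numbers is invariant under
associativity and commutativity and decreases strictly with every rewrite step, so every term has an
irreducible reduct (`exists_reduces_isIrreducible`).  The additional rewrite rules are derivable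
(`ExtraRule.provable`), hence a term is provably equal to its reducts, and terms with the same
normal form are provably equal (`SameNormalForm.provable`).

*Irreducible terms are Laurent polynomials.*  An irreducible term of sort `G` other than `id` is a
product of terms `g`, `g ^ m` and their inverses, where `g` is a variable and `m` is a product of
variables, terms `box a` and inverses of those of sort `NZE`.  Treating `box a` as a new variable,
it denotes a Laurent polynomial with integer coefficients.  Irreducibility excludes cancellation
both within the monomials and between the summands, so the polynomial determines the term modulo
associativity and commutativity (`IsIrreducible.acEquiv_of_laurent_eq`).

*Separation.*  Let two irreducible terms be different modulo associativity and commutativity, and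
consider them together with all arguments of `box` in them.  The differences of their Laurent
polynomials are nonzero whenever the terms differ, so there is a point at which none of these
differences vanishes, in every field in which a certain nonzero integer does not vanish
(`exists_laurentEval_ne_zero`).  As different arguments of `box` now have different values, the
values chosen for the new variables `box a` are those of a box function, and the two terms are
distinguished (`IsIrreducible.exists_eval_ne`).

The last step applies to `ℚ`, to `𝔽_q` for large `q`, and to nonprincipal ultraproducts of the
`𝔽_q`, which have characteristic zero.  The argument is the same with and without `box` in the
signature, and is carried out for both languages at once (`DHTerm.tfae_ofField`).
-/

namespace DHTerm

/-! ### Termination -/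

section Termination

variable {L : DHLang} {X : DHSort → Type*}

/-- A polynomial interpretation of terms in the natural numbers `≥ 2`.  It is invariant under
associativity and commutativity, strictly monotone in every argument, and strictly decreased by
every rewrite rule. -/
def weight : {σ : DHSort} → DHTerm L X σ → ℕ
  | _, var _ => 2
  | _, gop a b => a.weight + b.weight + 2
  | _, gid => 2
  | _, ginv a => 2 * a.weight + 1
  | _, exp a x => a.weight * (x.weight + 1)
  | _, box _ a => a.weight
  | _, add x y => x.weight + y.weight + 3
  | _, zero => 2
  | _, neg x => 2 * x.weight + 2
  | _, mul x y => x.weight * y.weight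
  | _, incl u => u.weight
  | _, one => 2
  | _, ninv u => u.weight * u.weight
  | _, nmul u v => u.weight * v.weight + 1

theorem two_le_weight {σ : DHSort} (s : DHTerm L X σ) : 2 ≤ s.weight := by
  induction s <;> simp only [weight] <;> first | omega | nlinarith

theorem ACAx.weight_eq {σ : DHSort} {s t : DHTerm L X σ} (h : ACAx s t) :
    s.weight = t.weight := by
  cases h <;> simp only [weight] <;> ring

theorem RewriteRule.weight_lt {σ : DHSort} {s t : DHTerm L X σ} (h : RewriteRule s t) :
    t.weight < s.weight := by
  have two_le := @two_le_weight L X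
  rcases h with h | h
  · cases h with
    | gop_gid b => simp only [weight]; omega
    | gop_ginv b => simp only [weight]; omega
    | add_zero x => simp only [weight]; omega
    | add_neg x => simp only [weight]; omega
    | mul_add x y z => simp only [weight]; nlinarith [two_le x]
    | mul_one x => simp only [weight]; nlinarith [two_le x]
    | nmul_eq u v => simp only [weight]; omega
    | mul_ninv u => simp only [weight]; nlinarith [two_le u, Nat.mul_le_mul (two_le u) (two_le u)]
    | ninv_nmul u v =>
      simp only [weight]
      nlinarith [Nat.mul_le_mul (two_le u) (two_le v)]
    | ninv_one => simp only [weight]; omega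
    | ninv_ninv w =>
      simp only [weight]
      nlinarith [two_le w, Nat.mul_le_mul (two_le w) (two_le w)]
    | exp_exp a x y =>
      simp only [weight]
      nlinarith [Nat.mul_le_mul (two_le a) (two_le x), Nat.mul_le_mul (two_le a) (two_le y)]
    | exp_one a => simp only [weight]; nlinarith [two_le a]
    | gop_exp a b x => simp only [weight]; nlinarith [two_le x]
    | exp_add a x y => simp only [weight]; nlinarith [two_le a]
    | gid_exp x => simp only [weight]; nlinarith [two_le x]
  · cases h with
    | ginv_gid => simp only [weight]; omega
    | ginv_gop a b => simp only [weight]; omega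
    | ginv_ginv b => simp only [weight]; omega
    | ginv_exp a x => simp only [weight]; nlinarith [two_le x]
    | exp_zero a => simp only [weight]; nlinarith [two_le a]
    | exp_neg a x => simp only [weight]; nlinarith [two_le a]
    | neg_zero => simp only [weight]; omega
    | neg_add x y => simp only [weight]; omega
    | neg_neg x => simp only [weight]; omega
    | zero_mul x => simp only [weight]; nlinarith [two_le x]
    | neg_mul x y => simp only [weight]; nlinarith [two_le y]

theorem StepIn.weight_eq {σ : DHSort} {s t : DHTerm L X σ}
    (h : StepIn (fun {_} a b => ACAx a b) s t) : s.weight = t.weight := by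
  induction h with
  | root h => exact h.weight_eq
  | _ => simp only [weight, *]

theorem ACEquiv.weight_eq {σ : DHSort} {s t : DHTerm L X σ} (h : ACEquiv s t) :
    s.weight = t.weight := by
  induction h with
  | rel s t h => exact h.weight_eq
  | refl => rfl
  | symm _ _ _ ih => exact ih.symm
  | trans _ _ _ _ _ ih₁ ih₂ => exact ih₁.trans ih₂

theorem StepIn.weight_lt {σ : DHSort} {s t : DHTerm L X σ}
    (h : StepIn (fun {_} a b => RewriteRule a b) s t) : t.weight < s.weight := by
  have two_le := @two_le_weight L X
  induction h with
  | root h => exact h.weight_lt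
  | exp_left x _ ih => simp only [weight]; exact Nat.mul_lt_mul_of_pos_right ih (by omega)
  | exp_right a _ ih =>
    simp only [weight]; exact Nat.mul_lt_mul_of_pos_left (by omega) (by linarith [two_le a])
  | mul_left y _ ih =>
    simp only [weight]; exact Nat.mul_lt_mul_of_pos_right ih (by linarith [two_le y])
  | mul_right x _ ih =>
    simp only [weight]; exact Nat.mul_lt_mul_of_pos_left ih (by linarith [two_le x])
  | ninv _ ih => simp only [weight]; exact Nat.mul_self_lt_mul_self ih
  | nmul_left v _ ih =>
    simp only [weight]
    exact Nat.succ_lt_succ (Nat.mul_lt_mul_of_pos_right ih (by linarith [two_le v]))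
  | nmul_right u _ ih =>
    simp only [weight]
    exact Nat.succ_lt_succ (Nat.mul_lt_mul_of_pos_left ih (by linarith [two_le u]))
  | _ => simp only [weight]; omega

theorem Rewrites.weight_lt {σ : DHSort} {s t : DHTerm L X σ} (h : Rewrites s t) :
    t.weight < s.weight := by
  obtain ⟨s', t', hs, h, ht⟩ := h
  rw [hs.weight_eq, ← ht.weight_eq]
  exact h.weight_lt

theorem exists_reduces_isIrreducible {σ : DHSort} (s : DHTerm L X σ) :
    ∃ s', Reduces s s' ∧ IsIrreducible s' := by
  induction hn : s.weight using Nat.strong_induction_on generalizing s with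
  | _ n ih =>
    subst hn
    by_cases h : IsIrreducible s
    · exact ⟨s, .refl, h⟩
    · simp only [IsIrreducible, not_forall, not_not] at h
      obtain ⟨t, ht⟩ := h
      obtain ⟨s', h₁, h₂⟩ := ih _ ht.weight_lt t rfl
      exact ⟨s', .head ht h₁, h₂⟩

end Termination

/-! ### Soundness of reduction and of derivability -/

section Derivability

variable (L : DHLang) (X : DHSort → Type*)

/-- Provable equality on terms of one sort. -/
def provableSetoid (σ : DHSort) : Setoid (DHTerm L X σ) where
  r := Provable
  iseqv := ⟨.refl, .symm, .trans⟩

/-- Terms of sort `G` modulo provable equality: the free `DH`-group. -/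
abbrev ProvableG : Type _ := Quotient (provableSetoid L X .G)

/-- Terms of sort `E` modulo provable equality. -/
abbrev ProvableE : Type _ := Quotient (provableSetoid L X .E)

variable {L X}

theorem Provable.base {σ : DHSort} {s t : DHTerm L X σ} (h : BaseRule s t) : Provable s t :=
  .ax (.inr h)

theorem Provable.ac {σ : DHSort} {s t : DHTerm L X σ} (h : ACAx s t) : Provable s t :=
  .ax (.inl h)

instance : CommGroup (ProvableG L X) :=
  letI : Mul (ProvableG L X) := ⟨Quotient.map₂ .gop fun _ _ h _ _ k => .gop h k⟩
  letI : Inv (ProvableG L X) := ⟨Quotient.map .ginv fun _ _ h => .ginv h⟩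
  letI : One (ProvableG L X) := ⟨Quotient.mk _ gid⟩
  have comm (a b : ProvableG L X) : a * b = b * a :=
    Quotient.inductionOn₂ a b fun a b => Quotient.sound (.ac (.gop_comm a b))
  { Group.ofRightAxioms
      (fun a b c : ProvableG L X => Quotient.inductionOn₃ a b c fun a b c =>
        Quotient.sound (.ac (.gop_assoc a b c)))
      (fun a => Quotient.inductionOn a fun a => Quotient.sound (.base (.gop_gid a)))
      (fun a => Quotient.inductionOn a fun a => Quotient.sound (.base (.gop_ginv a))) with
    mul_comm := comm }

instance : CommRing (ProvableE L X) :=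
  letI : Add (ProvableE L X) := ⟨Quotient.map₂ .add fun _ _ h _ _ k => .add h k⟩
  letI : Mul (ProvableE L X) := ⟨Quotient.map₂ .mul fun _ _ h _ _ k => .mul h k⟩
  letI : Neg (ProvableE L X) := ⟨Quotient.map .neg fun _ _ h => .neg h⟩
  letI : Zero (ProvableE L X) := ⟨Quotient.mk _ zero⟩
  letI : One (ProvableE L X) := ⟨Quotient.mk _ (incl one)⟩
  have add_comm' (x y : ProvableE L X) : x + y = y + x :=
    Quotient.inductionOn₂ x y fun x y => Quotient.sound (.ac (.add_comm x y))
  CommRing.ofMinimalAxioms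
    (fun x y z => Quotient.inductionOn₃ x y z fun x y z =>
      Quotient.sound (.ac (.add_assoc x y z)))
    (fun x => (add_comm' 0 x).trans
      (Quotient.inductionOn x fun x => Quotient.sound (.base (.add_zero x))))
    (fun x => (add_comm' (-x) x).trans
      (Quotient.inductionOn x fun x => Quotient.sound (.base (.add_neg x))))
    (fun x y z => Quotient.inductionOn₃ x y z fun x y z =>
      Quotient.sound (.ac (.mul_assoc x y z)))
    (fun x y => Quotient.inductionOn₂ x y fun x y => Quotient.sound (.ac (.mul_comm x y)))
    (fun x => Quotient.inductionOn x fun x =>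
      Quotient.sound (.trans (.ac (.mul_comm _ _)) (.base (.mul_one x))))
    (fun x y z => Quotient.inductionOn₃ x y z fun x y z =>
      Quotient.sound (.base (.mul_add x y z)))

theorem provableG_eq_iff {a b : DHTerm L X .G} :
    (Quotient.mk _ a : ProvableG L X) = Quotient.mk _ b ↔ Provable a b :=
  Quotient.eq (r := provableSetoid L X .G)

theorem provableE_eq_iff {x y : DHTerm L X .E} :
    (Quotient.mk _ x : ProvableE L X) = Quotient.mk _ y ↔ Provable x y :=
  Quotient.eq (r := provableSetoid L X .E)

theorem Provable.ginv_unique {a b : DHTerm L X .G} (h : Provable (.gop a b) .gid) :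
    Provable b (.ginv a) := by
  have h : (Quotient.mk _ a : ProvableG L X) * Quotient.mk _ b = 1 := provableG_eq_iff.2 h
  exact provableG_eq_iff.1 (eq_inv_of_mul_eq_one_right h)

theorem Provable.exp_zero (a : DHTerm L X .G) : Provable (.exp a .zero) .gid := by
  have h : (Quotient.mk _ (.exp a .zero) : ProvableG L X) * Quotient.mk _ (.exp a .zero) =
      Quotient.mk _ (.exp a .zero) :=
    provableG_eq_iff.2 (.trans (.symm (.base (.exp_add a .zero .zero)))
      (.exp (.refl a) (.base (.add_zero _))))
  exact provableG_eq_iff.1 (mul_eq_left.1 h)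

theorem ExtraRule.provable {σ : DHSort} {s t : DHTerm L X σ} (h : ExtraRule s t) :
    Provable s t := by
  cases h with
  | ginv_gid => exact provableG_eq_iff.1 (inv_one (G := ProvableG L X))
  | ginv_gop a b =>
    exact provableG_eq_iff.1 (mul_inv (Quotient.mk _ a : ProvableG L X) (Quotient.mk _ b))
  | ginv_ginv b => exact provableG_eq_iff.1 (inv_inv (Quotient.mk _ b : ProvableG L X))
  | ginv_exp a x =>
    refine .ginv_unique (.trans (.symm (.base (.gop_exp a (.ginv a) x))) ?_)
    exact .trans (.exp (.base (.gop_ginv a)) (.refl x)) (.base (.gid_exp x))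
  | exp_zero a => exact .exp_zero a
  | exp_neg a x =>
    refine .ginv_unique (.trans (.symm (.base (.exp_add a x (.neg x)))) ?_)
    exact .trans (.exp (.refl a) (.base (.add_neg x))) (.exp_zero a)
  | neg_zero => exact provableE_eq_iff.1 (_root_.neg_zero (G := ProvableE L X))
  | neg_add x y =>
    exact provableE_eq_iff.1 (_root_.neg_add (Quotient.mk _ x : ProvableE L X) (Quotient.mk _ y))
  | neg_neg x => exact provableE_eq_iff.1 (_root_.neg_neg (Quotient.mk _ x : ProvableE L X))
  | zero_mul x => exact provableE_eq_iff.1 (MulZeroClass.zero_mul (Quotient.mk _ x : ProvableE L X))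
  | neg_mul x y =>
    exact provableE_eq_iff.1 (_root_.neg_mul (Quotient.mk _ x : ProvableE L X) (Quotient.mk _ y))

theorem StepIn.provable {R : ∀ {σ : DHSort}, DHTerm L X σ → DHTerm L X σ → Prop}
    (hR : ∀ {σ : DHSort} {a b : DHTerm L X σ}, R a b → Provable a b)
    {σ : DHSort} {s t : DHTerm L X σ} (h : StepIn R s t) : Provable s t := by
  induction h with
  | root h => exact hR h
  | gop_left b _ ih => exact .gop ih (.refl _)
  | gop_right a _ ih => exact .gop (.refl _) ih
  | ginv _ ih => exact .ginv ih
  | exp_left x _ ih => exact .exp ih (.refl _)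
  | exp_right a _ ih => exact .exp (.refl _) ih
  | box h _ ih => exact .box h ih
  | add_left y _ ih => exact .add ih (.refl _)
  | add_right x _ ih => exact .add (.refl _) ih
  | neg _ ih => exact .neg ih
  | mul_left y _ ih => exact .mul ih (.refl _)
  | mul_right x _ ih => exact .mul (.refl _) ih
  | incl _ ih => exact .incl ih
  | ninv _ ih => exact .ninv ih
  | nmul_left v _ ih => exact .nmul ih (.refl _)
  | nmul_right u _ ih => exact .nmul (.refl _) ih

theorem ACEquiv.provable {σ : DHSort} {s t : DHTerm L X σ} (h : ACEquiv s t) :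
    Provable s t := by
  induction h with
  | rel s t h => exact h.provable .ac
  | refl => exact .refl _
  | symm _ _ _ ih => exact .symm ih
  | trans _ _ _ _ _ ih₁ ih₂ => exact .trans ih₁ ih₂

theorem Reduces.provable {σ : DHSort} {s t : DHTerm L X σ} (h : Reduces s t) :
    Provable s t := by
  induction h with
  | refl => exact .refl _
  | tail _ h ih =>
    obtain ⟨s', t', hs, h, ht⟩ := h
    refine .trans ih (.trans hs.provable (.trans (h.provable fun h => ?_) ht.provable))
    exact h.elim .base ExtraRule.provable

theorem Provable.eval_eq {F : Type} [Field F] (b : L.HasBox → F → Fˣ)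
    (η : ∀ σ, X σ → (DHStructure.ofField L F b).carrier σ)
    {σ : DHSort} {s t : DHTerm L X σ} (h : Provable s t) :
    (DHStructure.ofField L F b).eval η s = (DHStructure.ofField L F b).eval η t := by
  induction h with
  | ax h =>
    rcases h with h | h <;> cases h <;> simp only [DHStructure.eval] <;>
      first
        | simp; done
        | ring
        | simp [mul_comm]
  | refl => rfl
  | symm _ ih => exact ih.symm
  | trans _ _ ih₁ ih₂ => exact ih₁.trans ih₂
  | of_incl _ ih => exact Units.ext ih
  | _ => simp only [DHStructure.eval, *]

theorem Provable.satisfies {F : Type} [Field F] (b : L.HasBox → F → Fˣ)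
    {σ : DHSort} {s t : DHTerm L X σ} (h : Provable s t) :
    (DHStructure.ofField L F b).Satisfies s t := fun η => h.eval_eq b η

theorem Provable.toFull {σ : DHSort} {s t : DHTerm .boxFree X σ} (h : Provable s t) :
    Provable s.toFull t.toFull := by
  induction h with
  | ax h =>
    refine .ax ?_
    rcases h with h | h <;> cases h
    all_goals first
      | exact .inl (by constructor)
      | exact .inr (by constructor)
  | refl => exact .refl _
  | symm _ ih => exact .symm ih
  | trans _ _ ih₁ ih₂ => exact .trans ih₁ ih₂
  | gop _ _ ih₁ ih₂ => exact .gop ih₁ ih₂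
  | ginv _ ih => exact .ginv ih
  | exp _ _ ih₁ ih₂ => exact .exp ih₁ ih₂
  | box h => exact h.elim
  | add _ _ ih₁ ih₂ => exact .add ih₁ ih₂
  | neg _ ih => exact .neg ih
  | mul _ _ ih₁ ih₂ => exact .mul ih₁ ih₂
  | incl _ ih => exact .incl ih
  | of_incl _ ih => exact .of_incl ih
  | ninv _ ih => exact .ninv ih
  | nmul _ _ ih₁ ih₂ => exact .nmul ih₁ ih₂

theorem eval_toFull {F : Type} [Field F] (b : F → Fˣ)
    (η : ∀ σ, X σ → (DHStructure.withoutBox F).carrier σ) {σ : DHSort}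
    (s : DHTerm .boxFree X σ) :
    (DHStructure.withBox F b).eval η s.toFull = (DHStructure.withoutBox F).eval η s := by
  induction s with
  | var => rfl
  | box h => exact h.elim
  | _ => simp only [DHTerm.toFull, DHStructure.eval, *]

end Derivability
end DHTerm

/-! ### Signed multisets and Laurent polynomials -/

section Laurent

/-- The formal sum `∑ ±β` of a multiset of signed elements. -/
noncomputable def signedSum {β : Type*} (M : Multiset (β × Bool)) : β →₀ ℤ :=
  (M.map fun p => Finsupp.single p.1 (if p.2 then 1 else -1)).sum

/-- No element occurs with both signs. -/
def NoOpposites {β : Type*} (M : Multiset (β × Bool)) : Prop :=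
  ∀ b, (b, true) ∈ M → (b, false) ∉ M

theorem signedSum_zero {β : Type*} : signedSum (0 : Multiset (β × Bool)) = 0 := by
  simp [signedSum]

theorem signedSum_add {β : Type*} (M N : Multiset (β × Bool)) :
    signedSum (M + N) = signedSum M + signedSum N := by
  simp [signedSum]

theorem signedSum_singleton {β : Type*} (p : β × Bool) :
    signedSum {p} = Finsupp.single p.1 (if p.2 then 1 else -1) := by
  simp [signedSum]

theorem signedSum_apply {β : Type*} [DecidableEq β] (M : Multiset (β × Bool)) (b : β) :
    signedSum M b = M.count (b, true) - M.count (b, false) := by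
  induction M using Multiset.induction with
  | empty => simp [signedSum]
  | cons p M ih =>
    obtain ⟨c, ε⟩ := p
    rw [← Multiset.singleton_add, signedSum_add, signedSum_singleton, Finsupp.add_apply, ih]
    simp only [Multiset.count_add, Multiset.count_singleton, Finsupp.single_apply, Prod.mk.injEq]
    rcases eq_or_ne c b with rfl | h
    · cases ε <;> simp <;> omega
    · simp [h, h.symm]

/-- A multiset without cancellations is determined by its formal sum. -/
theorem NoOpposites.eq_of_signedSum_eq {β : Type*} {M N : Multiset (β × Bool)}
    (hM : NoOpposites M) (hN : NoOpposites N) (h : signedSum M = signedSum N) : M = N := by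
  classical
  have zero (M : Multiset (β × Bool)) (hM : NoOpposites M) (b : β) :
      M.count (b, true) = 0 ∨ M.count (b, false) = 0 := by
    by_cases h : (b, true) ∈ M
    · exact .inr (Multiset.count_eq_zero.2 (hM b h))
    · exact .inl (Multiset.count_eq_zero.2 h)
  ext ⟨b, ε⟩
  have hb := DFunLike.congr_fun h b
  rw [signedSum_apply, signedSum_apply] at hb
  rcases zero M hM b with h₁ | h₁ <;> rcases zero N hN b with h₂ | h₂ <;> cases ε <;> omega

variable {Γ : Type*} {F : Type} [Field F]

/-- The value of the Laurent monomial with exponent vector `d`. -/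
noncomputable def laurentMonomial (v : Γ → Fˣ) (d : Γ →₀ ℤ) : Fˣ := d.prod fun γ n => v γ ^ n

theorem laurentMonomial_zero (v : Γ → Fˣ) : laurentMonomial v 0 = 1 := by
  simp [laurentMonomial]

theorem laurentMonomial_add (v : Γ → Fˣ) (d e : Γ →₀ ℤ) :
    laurentMonomial v (d + e) = laurentMonomial v d * laurentMonomial v e :=
  Finsupp.prod_add_index' (by simp) fun γ m n => zpow_add (v γ) m n

theorem laurentMonomial_neg (v : Γ → Fˣ) (d : Γ →₀ ℤ) :
    laurentMonomial v (-d) = (laurentMonomial v d)⁻¹ := by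
  rw [eq_inv_iff_mul_eq_one, ← laurentMonomial_add, neg_add_cancel, laurentMonomial_zero]

theorem laurentMonomial_single (v : Γ → Fˣ) (γ : Γ) :
    laurentMonomial v (Finsupp.single γ 1) = v γ := by
  simp [laurentMonomial]

/-- The value of the Laurent polynomial whose coefficients are given by `P`. -/
noncomputable def laurentEval (v : Γ → Fˣ) (P : (Γ →₀ ℤ) →₀ ℤ) : F :=
  P.sum fun d c => c * (laurentMonomial v d : F)

theorem laurentEval_add (v : Γ → Fˣ) (P Q : (Γ →₀ ℤ) →₀ ℤ) :
    laurentEval v (P + Q) = laurentEval v P + laurentEval v Q :=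
  Finsupp.sum_add_index' (by simp) fun d m n => by push_cast; ring

theorem laurentEval_neg (v : Γ → Fˣ) (P : (Γ →₀ ℤ) →₀ ℤ) :
    laurentEval v (-P) = -laurentEval v P := by
  rw [eq_neg_iff_add_eq_zero, ← laurentEval_add, neg_add_cancel]
  simp [laurentEval]

theorem laurentEval_single (v : Γ → Fˣ) (d : Γ →₀ ℤ) (c : ℤ) :
    laurentEval v (Finsupp.single d c) = c * (laurentMonomial v d : F) := by
  simp [laurentEval]

/-- Clearing denominators: a nonzero Laurent polynomial is, up to a unit at every point of the
torus, a nonzero polynomial. -/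
theorem exists_mvPolynomial_of_laurent {P : (Γ →₀ ℤ) →₀ ℤ} (hP : P ≠ 0) :
    ∃ Q : MvPolynomial Γ ℤ, Q ≠ 0 ∧ ∀ (F : Type) [Field F] (v : Γ → Fˣ),
      laurentEval v P = 0 → MvPolynomial.aeval (fun γ => (v γ : F)) Q = 0 := by
  classical
  let m : Γ →₀ ℤ := ∑ d ∈ P.support, d.mapRange (fun n => |n|) (by simp)
  let e : (Γ →₀ ℤ) → (Γ →₀ ℕ) := fun d => (d + m).mapRange Int.toNat (by simp)
  have m_ge : ∀ d ∈ P.support, ∀ γ, 0 ≤ d γ + m γ := fun d hd γ => by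
    have : |d γ| ≤ m γ := by
      simp only [m, Finsupp.finsetSum_apply, Finsupp.mapRange_apply]
      exact Finset.single_le_sum (f := fun d : Γ →₀ ℤ => |d γ|) (fun _ _ => abs_nonneg _) hd
    linarith [neg_abs_le (d γ)]
  have e_cast : ∀ d ∈ P.support, (e d).mapRange Nat.cast (by simp) = d + m := fun d hd => by
    ext γ
    simpa [e] using m_ge d hd γ
  clear_value e
  refine ⟨∑ d ∈ P.support, MvPolynomial.monomial (e d) (P d), fun h => ?_, fun F _ v h => ?_⟩
  · obtain ⟨d₀, hd₀⟩ := Finsupp.support_nonempty_iff.2 hP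
    have h₀ := congrArg (MvPolynomial.coeff (e d₀)) h
    rw [MvPolynomial.coeff_sum, Finset.sum_eq_single d₀ ?_ (fun h => absurd hd₀ h)] at h₀
    · rw [MvPolynomial.coeff_monomial, if_pos rfl, MvPolynomial.coeff_zero] at h₀
      exact Finsupp.mem_support_iff.1 hd₀ h₀
    · intro d hd hne
      rw [MvPolynomial.coeff_monomial, if_neg]
      intro he
      have := e_cast d hd
      rw [he, e_cast d₀ hd₀] at this
      exact hne (add_right_cancel this).symm
  · have key : ∀ d ∈ P.support, MvPolynomial.aeval (fun γ => (v γ : F))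
        (MvPolynomial.monomial (e d) (P d)) =
          (P d * (laurentMonomial v d : F)) * (laurentMonomial v m : F) := fun d hd => by
      rw [MvPolynomial.aeval_monomial, mul_assoc, ← Units.val_mul, ← laurentMonomial_add,
        ← e_cast d hd, laurentMonomial, Finsupp.prod_mapRange_index (by simp)]
      simp [Finsupp.prod]
    rw [map_sum, Finset.sum_congr rfl key, ← Finset.sum_mul]
    exact mul_eq_zero_of_left h _

/-- Finitely many nonzero Laurent polynomials over `ℤ` have a common non-root with nonzero
coordinates in every field in which a suitable nonzero integer does not vanish: reduce an integral
non-root of the product of their numerators. -/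
theorem exists_laurentEval_ne_zero {ι : Type*} (S : Finset ι) (P : ι → (Γ →₀ ℤ) →₀ ℤ)
    (hP : ∀ i ∈ S, P i ≠ 0) :
    ∃ N : ℤ, N ≠ 0 ∧ ∀ (F : Type) [Field F], (N : F) ≠ 0 →
      ∃ v : Γ → Fˣ, ∀ i ∈ S, laurentEval v (P i) ≠ 0 := by
  classical
  choose! Q hQ₀ hQ using fun i hi => exists_mvPolynomial_of_laurent (hP i hi)
  let R : MvPolynomial Γ ℤ := ∏ i ∈ S, Q i
  let T : MvPolynomial Γ ℤ := R * ∏ γ ∈ R.vars, MvPolynomial.X γ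
  have hT : T ≠ 0 := mul_ne_zero (Finset.prod_ne_zero_iff.2 hQ₀)
    (Finset.prod_ne_zero_iff.2 fun γ _ => MvPolynomial.X_ne_zero γ)
  obtain ⟨u, hu⟩ : ∃ u, MvPolynomial.eval u T ≠ 0 := by
    by_contra! h
    exact hT (MvPolynomial.funext fun u => by simpa using h u)
  refine ⟨MvPolynomial.eval u T, hu, fun F _ hN => ?_⟩
  -- variables that do not occur may vanish at `u`; they are sent to `1`
  let v : Γ → Fˣ := fun γ => if h : (u γ : F) = 0 then 1 else Units.mk0 (u γ : F) h
  refine ⟨v, fun i hi h => hN ?_⟩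
  simp only [T, map_mul, map_prod, MvPolynomial.eval_X, Int.cast_mul, Int.cast_prod] at hN ⊢
  have hR : MvPolynomial.aeval (fun γ => (v γ : F)) R = ((MvPolynomial.eval u R : ℤ) : F) := by
    have : ((MvPolynomial.eval u R : ℤ) : F) = MvPolynomial.aeval (fun γ => (u γ : F)) R := by
      rw [MvPolynomial.aeval_def, ← eq_intCast (algebraMap ℤ F), MvPolynomial.eval,
        MvPolynomial.coe_eval₂Hom, MvPolynomial.hom_eval₂]
      rfl
    rw [this]
    refine MvPolynomial.eval₂Hom_congr' rfl (fun γ hγ _ => ?_) rfl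
    have : (u γ : F) ≠ 0 := Finset.prod_ne_zero_iff.1 (right_ne_zero_of_mul hN) γ hγ
    simp [v, this]
  have hR₀ : MvPolynomial.aeval (fun γ => (v γ : F)) R = 0 := by
    rw [map_prod]
    exact Finset.prod_eq_zero hi (hQ i hi F v h)
  rw [← hR, hR₀, zero_mul]

end Laurent

namespace DHTerm

/-! ### Contexts and terms modulo associativity and commutativity -/

section ACClasses

variable {L : DHLang} {X : DHSort → Type*}

/-- A map between terms that preserves one-step replacement, such as filling a one-hole context. -/
def IsContext {σ τ : DHSort} (f : DHTerm L X σ → DHTerm L X τ) : Prop :=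
  ∀ (R : ∀ {σ : DHSort}, DHTerm L X σ → DHTerm L X σ → Prop) {s t : DHTerm L X σ},
    StepIn R s t → StepIn R (f s) (f t)

section IsContext

variable {σ τ : DHSort} {f : DHTerm L X σ → DHTerm L X τ}

theorem IsContext.acEquiv (hf : IsContext f) {s t : DHTerm L X σ} (h : ACEquiv s t) :
    ACEquiv (f s) (f t) := by
  induction h with
  | rel s t h => exact .rel _ _ (hf _ h)
  | refl => exact .refl _
  | symm _ _ _ ih => exact .symm _ _ ih
  | trans _ _ _ _ _ ih₁ ih₂ => exact .trans _ _ _ ih₁ ih₂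

theorem IsContext.isIrreducible (hf : IsContext f) {s : DHTerm L X σ}
    (h : IsIrreducible (f s)) : IsIrreducible s := by
  rintro t ⟨s', t', hs, hst, ht⟩
  exact h (f t) ⟨f s', f t', hf.acEquiv hs, hf _ hst, hf.acEquiv ht⟩

theorem isContext_gop_left (b : DHTerm L X .G) : IsContext fun a => gop a b :=
  fun _ _ _ h => .gop_left b h

theorem isContext_gop_right (a : DHTerm L X .G) : IsContext fun b => gop a b :=
  fun _ _ _ h => .gop_right a h

theorem isContext_ginv : IsContext (ginv : DHTerm L X .G → _) := fun _ _ _ h => .ginv h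

theorem isContext_exp_left (x : DHTerm L X .E) : IsContext fun a => exp a x :=
  fun _ _ _ h => .exp_left x h

theorem isContext_exp_right (a : DHTerm L X .G) : IsContext fun x => exp a x :=
  fun _ _ _ h => .exp_right a h

theorem isContext_box (h : L.HasBox) : IsContext (box h : DHTerm L X .G → _) :=
  fun _ _ _ k => .box h k

theorem isContext_add_left (y : DHTerm L X .E) : IsContext fun x => add x y :=
  fun _ _ _ h => .add_left y h

theorem isContext_add_right (x : DHTerm L X .E) : IsContext fun y => add x y :=
  fun _ _ _ h => .add_right x h

theorem isContext_neg : IsContext (neg : DHTerm L X .E → _) := fun _ _ _ h => .neg h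

theorem isContext_mul_left (y : DHTerm L X .E) : IsContext fun x => mul x y :=
  fun _ _ _ h => .mul_left y h

theorem isContext_mul_right (x : DHTerm L X .E) : IsContext fun y => mul x y :=
  fun _ _ _ h => .mul_right x h

theorem isContext_incl : IsContext (incl : DHTerm L X .NZE → _) := fun _ _ _ h => .incl h

theorem isContext_ninv : IsContext (ninv : DHTerm L X .NZE → _) := fun _ _ _ h => .ninv h

theorem isContext_nmul_left (v : DHTerm L X .NZE) : IsContext fun u => nmul u v :=
  fun _ _ _ h => .nmul_left v h

theorem isContext_nmul_right (u : DHTerm L X .NZE) : IsContext fun v => nmul u v :=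
  fun _ _ _ h => .nmul_right u h

end IsContext

theorem ACEquiv.of_ax {σ : DHSort} {s t : DHTerm L X σ} (h : ACAx s t) : ACEquiv s t :=
  .rel _ _ (.root h)

theorem ACEquiv.gop {a a' b b' : DHTerm L X .G} (h : ACEquiv a a') (k : ACEquiv b b') :
    ACEquiv (gop a b) (gop a' b') :=
  .trans _ _ _ ((isContext_gop_left b).acEquiv h) ((isContext_gop_right a').acEquiv k)

theorem ACEquiv.exp {a a' : DHTerm L X .G} {x x' : DHTerm L X .E} (h : ACEquiv a a')
    (k : ACEquiv x x') : ACEquiv (exp a x) (exp a' x') :=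
  .trans _ _ _ ((isContext_exp_left x).acEquiv h) ((isContext_exp_right a').acEquiv k)

theorem ACEquiv.mul {x x' y y' : DHTerm L X .E} (h : ACEquiv x x') (k : ACEquiv y y') :
    ACEquiv (mul x y) (mul x' y') :=
  .trans _ _ _ ((isContext_mul_left y).acEquiv h) ((isContext_mul_right x').acEquiv k)

theorem IsIrreducible.of_acEquiv {σ : DHSort} {s t : DHTerm L X σ} (h : IsIrreducible s)
    (k : ACEquiv s t) : IsIrreducible t := by
  rintro r ⟨t', r', ht, htr, hr⟩
  exact h r ⟨t', r', .trans _ _ _ k ht, htr, hr⟩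

theorem IsIrreducible.not_base {σ : DHSort} {s t : DHTerm L X σ} (h : IsIrreducible s) :
    ¬ BaseRule s t :=
  fun k => h t ⟨s, t, .refl _, .root (.inl k), .refl _⟩

theorem IsIrreducible.not_extra {σ : DHSort} {s t : DHTerm L X σ} (h : IsIrreducible s) :
    ¬ ExtraRule s t :=
  fun k => h t ⟨s, t, .refl _, .root (.inr k), .refl _⟩

theorem IsIrreducible.gop_comm {a b : DHTerm L X .G} (h : IsIrreducible (gop a b)) :
    IsIrreducible (gop b a) :=
  h.of_acEquiv (.of_ax (.gop_comm a b))

theorem IsIrreducible.mul_comm {x y : DHTerm L X .E} (h : IsIrreducible (mul x y)) :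
    IsIrreducible (mul y x) :=
  h.of_acEquiv (.of_ax (.mul_comm x y))

variable (L X) in
/-- Identity modulo associativity and commutativity on terms of one sort. -/
def acSetoid (σ : DHSort) : Setoid (DHTerm L X σ) where
  r := ACEquiv
  iseqv := Relation.EqvGen.is_equivalence _

variable (L X) in
/-- Terms of one sort modulo associativity and commutativity. -/
abbrev ACClass (σ : DHSort) : Type _ := Quotient (acSetoid L X σ)

/-- The class of a term modulo associativity and commutativity. -/
def acClass {σ : DHSort} (s : DHTerm L X σ) : ACClass L X σ := Quotient.mk _ s

theorem acClass_eq_iff {σ : DHSort} {s t : DHTerm L X σ} :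
    acClass s = acClass t ↔ ACEquiv s t :=
  Quotient.eq (r := acSetoid L X σ)

instance : CommSemigroup (ACClass L X .G) where
  mul := Quotient.map₂ gop fun _ _ h _ _ k => ACEquiv.gop h k
  mul_assoc a b c := Quotient.inductionOn₃ a b c fun a b c =>
    Quotient.sound (ACEquiv.of_ax (.gop_assoc a b c))
  mul_comm a b := Quotient.inductionOn₂ a b fun a b =>
    Quotient.sound (ACEquiv.of_ax (.gop_comm a b))

instance : CommSemigroup (ACClass L X .E) where
  mul := Quotient.map₂ mul fun _ _ h _ _ k => ACEquiv.mul h k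
  mul_assoc a b c := Quotient.inductionOn₃ a b c fun a b c =>
    Quotient.sound (ACEquiv.of_ax (.mul_assoc a b c))
  mul_comm a b := Quotient.inductionOn₂ a b fun a b =>
    Quotient.sound (ACEquiv.of_ax (.mul_comm a b))

theorem acClass_gop (a b : DHTerm L X .G) : acClass (gop a b) = acClass a * acClass b := rfl

theorem acClass_mul (x y : DHTerm L X .E) : acClass (mul x y) = acClass x * acClass y := rfl

/-- The unit of `WithOne` stands for an empty remainder, so that the hypothesis says that `r` is,
modulo associativity and commutativity, the whole term or one of two factors of it. -/
theorem IsIrreducible.of_acClass_eq_gop {s r : DHTerm L X .G} (hs : IsIrreducible s)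
    {w : WithOne (ACClass L X .G)} (h : (acClass s : WithOne (ACClass L X .G)) = acClass r * w) :
    IsIrreducible r := by
  induction w using WithOne.recOneCoe with
  | one =>
    rw [mul_one, WithOne.coe_inj, acClass_eq_iff] at h
    exact hs.of_acEquiv h
  | coe q =>
    obtain ⟨t, rfl⟩ := Quotient.exists_rep q
    rw [← WithOne.coe_mul, WithOne.coe_inj] at h
    exact (isContext_gop_left t).isIrreducible (hs.of_acEquiv (acClass_eq_iff.1 h))

/-- The analogue for exponents of `IsIrreducible.of_acClass_eq_gop`. -/
theorem IsIrreducible.of_acClass_eq_mul {x r : DHTerm L X .E} (hx : IsIrreducible x)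
    {w : WithOne (ACClass L X .E)} (h : (acClass x : WithOne (ACClass L X .E)) = acClass r * w) :
    IsIrreducible r := by
  induction w using WithOne.recOneCoe with
  | one =>
    rw [_root_.mul_one, WithOne.coe_inj, acClass_eq_iff] at h
    exact hx.of_acEquiv h
  | coe q =>
    obtain ⟨t, rfl⟩ := Quotient.exists_rep q
    rw [← WithOne.coe_mul, WithOne.coe_inj] at h
    exact (isContext_mul_left t).isIrreducible (hx.of_acEquiv (acClass_eq_iff.1 h))

end ACClasses

/-! ### Irreducible terms as Laurent polynomials -/

section NormalForms

variable {L : DHLang} {X : DHSort → Type*}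

variable (L X) in
/-- Indeterminates of the Laurent polynomials attached to terms: classes of terms modulo
associativity and commutativity.  Only the classes of variables and of terms `box a` are used, so
that `box a` counts as a new variable that depends on the class of `a` alone. -/
abbrev Atom : Type _ := Σ σ : DHSort, ACClass L X σ

/-- The class of a term, as an indeterminate. -/
def atom {σ : DHSort} (s : DHTerm L X σ) : Atom L X := ⟨σ, acClass s⟩

theorem atom_eq_iff {σ : DHSort} {s t : DHTerm L X σ} : atom s = atom t ↔ ACEquiv s t := by
  rw [← acClass_eq_iff, atom, atom, Sigma.mk.injEq, heq_eq_eq, and_iff_right rfl]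

/-- The exponent vector of the Laurent monomial denoted by a product of variables, boxes and
inverses; for `a ^ x` the variables of sort `G` in `a` count as well.  The value `0` on sums, zeros
and negatives is a placeholder. -/
noncomputable def deg : {σ : DHSort} → DHTerm L X σ → (Atom L X →₀ ℤ)
  | _, var x => Finsupp.single (atom (var x)) 1
  | _, gop _ _ => 0
  | _, gid => 0
  | _, ginv _ => 0
  | _, exp a x => a.deg + x.deg
  | _, box h a => Finsupp.single (atom (box h a)) 1
  | _, add _ _ => 0
  | _, zero => 0
  | _, neg _ => 0
  | _, mul x y => x.deg + y.deg
  | _, incl u => u.deg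
  | _, one => 0
  | _, ninv u => -u.deg
  | _, nmul u v => u.deg + v.deg

/-- The Laurent polynomial denoted by an irreducible term of sort `G`. -/
noncomputable def laurent : DHTerm L X .G → ((Atom L X →₀ ℤ) →₀ ℤ)
  | var g => Finsupp.single (var g).deg 1
  | gop a b => a.laurent + b.laurent
  | gid => 0
  | ginv a => -a.laurent
  | exp a x => Finsupp.single (exp a x).deg 1

/-- The irreducible exponents that can occur in an irreducible term of sort `G`. -/
structure IsMonomial (x : DHTerm L X .E) : Prop where
  irr : IsIrreducible x
  ne_one : x ≠ incl one
  ne_zero : x ≠ zero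
  ne_add : ∀ y z, x ≠ add y z
  ne_neg : ∀ y, x ≠ neg y

theorem IsMonomial.of_mul {x y : DHTerm L X .E} (h : IsIrreducible (mul x y)) :
    IsMonomial x where
  irr := (isContext_mul_left y).isIrreducible h
  ne_one := by rintro rfl; exact h.mul_comm.not_base (.mul_one y)
  ne_zero := by rintro rfl; exact h.not_extra (.zero_mul y)
  ne_add := by rintro a b rfl; exact h.mul_comm.not_base (.mul_add y a b)
  ne_neg := by rintro a rfl; exact h.not_extra (.neg_mul a y)

theorem IsMonomial.of_exp {a : DHTerm L X .G} {x : DHTerm L X .E} (h : IsIrreducible (exp a x)) :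
    IsMonomial x where
  irr := (isContext_exp_right a).isIrreducible h
  ne_one := by rintro rfl; exact h.not_base (.exp_one a)
  ne_zero := by rintro rfl; exact h.not_extra (.exp_zero a)
  ne_add := by rintro y z rfl; exact h.not_base (.exp_add a y z)
  ne_neg := by rintro y rfl; exact h.not_extra (.exp_neg a y)

/-- The class of the exponent `γ` or `γ⁻¹`, according to the sign. -/
def letterClass : Atom L X × Bool → WithOne (ACClass L X .E)
  | (⟨.G, _⟩, _) => 1
  | (⟨.E, q⟩, _) => q
  | (⟨.NZE, q⟩, true) =>
    ((Quotient.map incl fun _ _ h => isContext_incl.acEquiv h) q : ACClass L X .E)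
  | (⟨.NZE, q⟩, false) =>
    ((Quotient.map (fun u => incl (ninv u)) fun _ _ h =>
      isContext_incl.acEquiv (isContext_ninv.acEquiv h)) q : ACClass L X .E)

/-- A monomial is a product of signed letters, whose formal sum is its exponent vector. -/
theorem IsMonomial.exists_letters : ∀ {x : DHTerm L X .E}, IsMonomial x →
    ∃ M : Multiset (Atom L X × Bool), M ≠ 0 ∧ signedSum M = x.deg ∧
      (∀ p ∈ M, (p.1.1 = .E ∧ p.2 = true) ∨ p.1.1 = .NZE) ∧
      (acClass x : WithOne (ACClass L X .E)) = (M.map letterClass).prod := by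
  have single {x : DHTerm L X .E} (p : Atom L X × Bool) (h₁ : signedSum {p} = x.deg)
      (h₂ : (p.1.1 = .E ∧ p.2 = true) ∨ p.1.1 = .NZE)
      (h₃ : (acClass x : WithOne (ACClass L X .E)) = letterClass p) :
      ∃ M : Multiset (Atom L X × Bool), M ≠ 0 ∧ signedSum M = x.deg ∧
        (∀ p ∈ M, (p.1.1 = .E ∧ p.2 = true) ∨ p.1.1 = .NZE) ∧
        (acClass x : WithOne (ACClass L X .E)) = (M.map letterClass).prod :=
    ⟨{p}, Multiset.singleton_ne_zero p, h₁, by simpa using h₂, by simpa using h₃⟩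
  intro x
  induction hn : x.weight using Nat.strong_induction_on generalizing x with
  | _ n ih =>
  subst hn
  intro h
  cases x with
  | var e =>
    exact single (atom (var e), true) (by simp [signedSum_singleton, deg]) (.inl ⟨rfl, rfl⟩) rfl
  | add y z => exact absurd rfl (h.ne_add y z)
  | zero => exact absurd rfl h.ne_zero
  | neg y => exact absurd rfl (h.ne_neg y)
  | mul y z =>
    have hy := two_le_weight y
    have hz := two_le_weight z
    obtain ⟨M, hM₀, hM₁, hM₂, hM₃⟩ :=
      ih y.weight (by simp only [weight]; nlinarith) rfl (.of_mul h.irr)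
    obtain ⟨N, hN₀, hN₁, hN₂, hN₃⟩ :=
      ih z.weight (by simp only [weight]; nlinarith) rfl (.of_mul h.irr.mul_comm)
    refine ⟨M + N, by simp [hM₀], by rw [signedSum_add, hM₁, hN₁, deg], fun p hp => ?_, ?_⟩
    · exact (Multiset.mem_add.1 hp).elim (hM₂ p) (hN₂ p)
    · rw [acClass_mul, WithOne.coe_mul, hM₃, hN₃, Multiset.map_add, Multiset.prod_add]
  | incl u =>
    cases u with
    | var u =>
      exact single (atom (var u), true) (by simp [signedSum_singleton, deg]) (.inr rfl) rfl
    | box k a =>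
      exact single (atom (box k a), true) (by simp [signedSum_singleton, deg]) (.inr rfl) rfl
    | one => exact absurd rfl h.ne_one
    | nmul u w => exact absurd (.nmul_eq u w) h.irr.not_base
    | ninv u =>
      have hu := isContext_incl.isIrreducible h.irr
      cases u with
      | var u =>
        exact single (atom (var u), false) (by simp [signedSum_singleton, deg]) (.inr rfl) rfl
      | box k a =>
        exact single (atom (box k a), false) (by simp [signedSum_singleton, deg]) (.inr rfl) rfl
      | one => exact absurd .ninv_one hu.not_base
      | nmul u w => exact absurd (.ninv_nmul u w) hu.not_base
      | ninv u => exact absurd (.ninv_ninv u) hu.not_base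

/-- The rule `u * i(u) → 1` rules out cancellations between the letters of a monomial. -/
theorem IsMonomial.exists_reduced_letters {x : DHTerm L X .E} (h : IsMonomial x) :
    ∃ M : Multiset (Atom L X × Bool), M ≠ 0 ∧ NoOpposites M ∧ signedSum M = x.deg ∧
      (∀ p ∈ M, p.1.1 ≠ .G) ∧
      (acClass x : WithOne (ACClass L X .E)) = (M.map letterClass).prod := by
  obtain ⟨M, h₀, h₁, h₂, h₃⟩ := h.exists_letters
  refine ⟨M, h₀, fun γ hγ hγ' => ?_, h₁, fun p hp => ?_, h₃⟩
  · have hE := h₂ _ hγ'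
    obtain ⟨N, rfl⟩ := Multiset.exists_cons_of_mem hγ
    obtain ⟨N, rfl⟩ := Multiset.exists_cons_of_mem
      ((Multiset.mem_cons.1 hγ').resolve_left (by simp))
    obtain ⟨σ, q⟩ := γ
    obtain rfl : σ = .NZE := by simpa using hE
    obtain ⟨u, rfl⟩ := Quotient.exists_rep q
    rw [Multiset.map_cons, Multiset.map_cons, Multiset.prod_cons, Multiset.prod_cons,
      ← mul_assoc] at h₃
    have : IsIrreducible (mul (incl u) (incl (ninv u))) := h.irr.of_acClass_eq_mul h₃
    exact this.not_base (.mul_ninv u)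
  · rcases h₂ p hp with h | h <;> simp [h]

theorem IsMonomial.acEquiv_of_deg_eq {x y : DHTerm L X .E} (hx : IsMonomial x)
    (hy : IsMonomial y) (h : x.deg = y.deg) : ACEquiv x y := by
  obtain ⟨M, -, hM₁, hM₂, -, hM₃⟩ := hx.exists_reduced_letters
  obtain ⟨N, -, hN₁, hN₂, -, hN₃⟩ := hy.exists_reduced_letters
  obtain rfl := hM₁.eq_of_signedSum_eq hN₁ (by rw [hM₂, hN₂, h])
  exact acClass_eq_iff.1 (WithOne.coe_inj.1 (hM₃.trans hN₃.symm))

theorem IsMonomial.deg_ne_zero {x : DHTerm L X .E} (hx : IsMonomial x) : x.deg ≠ 0 := by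
  obtain ⟨M, hM₀, hM₁, hM₂, -, -⟩ := hx.exists_reduced_letters
  intro h
  exact hM₀ (hM₁.eq_of_signedSum_eq (N := 0) (by simp [NoOpposites])
    (by rw [hM₂, h, signedSum_zero]))

theorem IsMonomial.deg_apply_atom {x : DHTerm L X .E} (hx : IsMonomial x) (a : DHTerm L X .G) :
    x.deg (atom a) = 0 := by
  classical
  obtain ⟨M, -, -, hM₂, hM₃, -⟩ := hx.exists_reduced_letters
  rw [← hM₂, signedSum_apply, Multiset.count_eq_zero_of_notMem fun h => hM₃ _ h rfl,
    Multiset.count_eq_zero_of_notMem fun h => hM₃ _ h rfl, sub_self]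

/-- The irreducible summands of an irreducible term of sort `G`: a variable, or a variable raised
to a monomial. -/
inductive IsSummand : DHTerm L X .G → Prop where
  | var (g : X .G) : IsSummand (var g)
  | exp (g : X .G) {x : DHTerm L X .E} (hx : IsMonomial x) : IsSummand (exp (var g) x)

theorem IsIrreducible.isSummand_exp {a : DHTerm L X .G} {x : DHTerm L X .E}
    (h : IsIrreducible (exp a x)) : IsSummand (exp a x) := by
  cases a with
  | var g => exact .exp g (.of_exp h)
  | gop a b => exact absurd (.gop_exp a b x) h.not_base
  | gid => exact absurd (.gid_exp x) h.not_base
  | ginv a => exact absurd (.ginv_exp a x) h.not_extra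
  | exp a y => exact absurd (.exp_exp a y x) h.not_base

theorem IsIrreducible.isSummand_of_ginv {a : DHTerm L X .G} (h : IsIrreducible (ginv a)) :
    IsSummand a := by
  cases a with
  | var g => exact .var g
  | gop a b => exact absurd (.ginv_gop a b) h.not_extra
  | gid => exact absurd .ginv_gid h.not_extra
  | ginv a => exact absurd (.ginv_ginv a) h.not_extra
  | exp a x => exact (isContext_ginv.isIrreducible h).isSummand_exp

theorem IsSummand.laurent_eq {a : DHTerm L X .G} (h : IsSummand a) :
    a.laurent = Finsupp.single a.deg 1 := by
  cases h <;> rw [laurent]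

/-- A summand is a base variable with a remaining exponent vector, in which the atoms of sort `G`
do not occur. -/
theorem IsSummand.exists_deg_eq {a : DHTerm L X .G} (h : IsSummand a) :
    ∃ (g : X .G) (d : Atom L X →₀ ℤ), a.deg = Finsupp.single (atom (DHTerm.var g)) 1 + d ∧
      (∀ b : DHTerm L X .G, d (atom b) = 0) ∧
      ((d = 0 ∧ a = DHTerm.var g) ∨
        ∃ x, IsMonomial x ∧ x.deg = d ∧ a = DHTerm.exp (DHTerm.var g) x) := by
  cases h with
  | var g => exact ⟨g, 0, by simp [deg], by simp, .inl ⟨rfl, rfl⟩⟩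
  | @exp g x hx => exact ⟨g, x.deg, by simp [deg], hx.deg_apply_atom, .inr ⟨x, hx, rfl, rfl⟩⟩

theorem IsSummand.acEquiv_of_deg_eq {a b : DHTerm L X .G} (ha : IsSummand a) (hb : IsSummand b)
    (h : a.deg = b.deg) : ACEquiv a b := by
  classical
  obtain ⟨g, d, had, hd, ha⟩ := ha.exists_deg_eq
  obtain ⟨g', d', hbd, hd', hb⟩ := hb.exists_deg_eq
  rw [had, hbd] at h
  have hg : atom (DHTerm.var g : DHTerm L X .G) = atom (DHTerm.var g') := by
    have := DFunLike.congr_fun h (atom (DHTerm.var g))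
    by_contra hne
    simp [hd, hd', Ne.symm hne] at this
  rw [hg, add_right_inj] at h
  subst h
  have hg := atom_eq_iff.1 hg
  rcases ha with ⟨h₀, rfl⟩ | ⟨x, hx, hxd, rfl⟩ <;> rcases hb with ⟨h₀', rfl⟩ | ⟨y, hy, hyd, rfl⟩
  · exact hg
  · exact absurd (hyd.trans h₀) hy.deg_ne_zero
  · exact absurd (hxd.trans h₀') hx.deg_ne_zero
  · exact .exp hg (hx.acEquiv_of_deg_eq hy (hxd.trans hyd.symm))

open Classical in
/-- A summand with the given exponent vector, if there is one. -/
noncomputable def summandOf (d : Atom L X →₀ ℤ) : DHTerm L X .G :=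
  if h : ∃ a, IsSummand a ∧ a.deg = d then h.choose else gid

theorem IsSummand.acEquiv_summandOf {a : DHTerm L X .G} (h : IsSummand a) :
    ACEquiv a (summandOf a.deg) := by
  have ha : ∃ b : DHTerm L X .G, IsSummand b ∧ b.deg = a.deg := ⟨a, h, rfl⟩
  rw [summandOf, dif_pos ha]
  exact h.acEquiv_of_deg_eq ha.choose_spec.1 ha.choose_spec.2.symm

/-- The class of the summand with exponent vector `d` or of its inverse, according to the sign. -/
noncomputable def summandClass (p : (Atom L X →₀ ℤ) × Bool) : ACClass L X .G :=
  acClass (if p.2 then summandOf p.1 else ginv (summandOf p.1))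

/-- An irreducible term other than `id` is a product of signed summands, whose formal sum is its
Laurent polynomial. -/
theorem IsIrreducible.exists_summands : ∀ {s : DHTerm L X .G}, IsIrreducible s → s ≠ gid →
    ∃ M : Multiset ((Atom L X →₀ ℤ) × Bool), M ≠ 0 ∧ signedSum M = s.laurent ∧
      (acClass s : WithOne (ACClass L X .G)) = (M.map fun p => ↑(summandClass p)).prod
  | gid, _, h => absurd rfl h
  | var g, _, _ => by
    refine ⟨{((var g).deg, true)}, Multiset.singleton_ne_zero _, ?_, ?_⟩
    · simp [signedSum_singleton, laurent]
    · simpa [summandClass, acClass_eq_iff] using (IsSummand.var g).acEquiv_summandOf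
  | exp a x, h, _ => by
    refine ⟨{((exp a x).deg, true)}, Multiset.singleton_ne_zero _, ?_, ?_⟩
    · simp [signedSum_singleton, laurent]
    · simpa [summandClass, acClass_eq_iff] using h.isSummand_exp.acEquiv_summandOf
  | ginv a, h, _ => by
    have ha := h.isSummand_of_ginv
    refine ⟨{(a.deg, false)}, Multiset.singleton_ne_zero _, ?_, ?_⟩
    · simp [signedSum_singleton, laurent, ha.laurent_eq]
    · simpa [summandClass, acClass_eq_iff] using isContext_ginv.acEquiv ha.acEquiv_summandOf
  | gop a b, h, _ => by
    obtain ⟨M, hM₀, hM₁, hM₂⟩ := IsIrreducible.exists_summands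
      ((isContext_gop_left b).isIrreducible h)
      (by rintro rfl; exact h.gop_comm.not_base (.gop_gid b))
    obtain ⟨N, hN₀, hN₁, hN₂⟩ := IsIrreducible.exists_summands
      ((isContext_gop_right a).isIrreducible h)
      (by rintro rfl; exact h.not_base (.gop_gid a))
    refine ⟨M + N, by simp [hM₀], by rw [signedSum_add, hM₁, hN₁, laurent], ?_⟩
    rw [acClass_gop, WithOne.coe_mul, hM₂, hN₂, Multiset.map_add, Multiset.prod_add]

/-- The rule `b · inv(b) → id` rules out cancellations between the summands. -/
theorem IsIrreducible.exists_reduced_summands {s : DHTerm L X .G} (h : IsIrreducible s)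
    (hs : s ≠ gid) :
    ∃ M : Multiset ((Atom L X →₀ ℤ) × Bool), M ≠ 0 ∧ NoOpposites M ∧ signedSum M = s.laurent ∧
      (acClass s : WithOne (ACClass L X .G)) = (M.map fun p => ↑(summandClass p)).prod := by
  obtain ⟨M, h₀, h₁, h₂⟩ := h.exists_summands hs
  refine ⟨M, h₀, fun d hd hd' => ?_, h₁, h₂⟩
  obtain ⟨N, rfl⟩ := Multiset.exists_cons_of_mem hd
  obtain ⟨N, rfl⟩ := Multiset.exists_cons_of_mem
    ((Multiset.mem_cons.1 hd').resolve_left (by simp))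
  rw [Multiset.map_cons, Multiset.map_cons, Multiset.prod_cons, Multiset.prod_cons,
    ← mul_assoc] at h₂
  have : IsIrreducible (gop (summandOf d) (ginv (summandOf d))) := h.of_acClass_eq_gop h₂
  exact this.not_base (.gop_ginv _)

theorem IsIrreducible.laurent_ne_zero {s : DHTerm L X .G} (h : IsIrreducible s) (hs : s ≠ gid) :
    s.laurent ≠ 0 := by
  obtain ⟨M, hM₀, hM₁, hM₂, -⟩ := h.exists_reduced_summands hs
  intro h
  exact hM₀ (hM₁.eq_of_signedSum_eq (N := 0) (by simp [NoOpposites])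
    (by rw [hM₂, h, signedSum_zero]))

/-- An irreducible term is determined by its Laurent polynomial, modulo associativity and
commutativity. -/
theorem IsIrreducible.acEquiv_of_laurent_eq {s t : DHTerm L X .G} (hs : IsIrreducible s)
    (ht : IsIrreducible t) (h : s.laurent = t.laurent) : ACEquiv s t := by
  by_cases hs₀ : s = gid <;> by_cases ht₀ : t = gid
  · rw [hs₀, ht₀]; exact .refl _
  · subst hs₀; exact absurd (h.symm.trans (by rw [laurent])) (ht.laurent_ne_zero ht₀)
  · subst ht₀; exact absurd (h.trans (by rw [laurent])) (hs.laurent_ne_zero hs₀)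
  · obtain ⟨M, -, hM₁, hM₂, hM₃⟩ := hs.exists_reduced_summands hs₀
    obtain ⟨N, -, hN₁, hN₂, hN₃⟩ := ht.exists_reduced_summands ht₀
    obtain rfl := hM₁.eq_of_signedSum_eq hN₁ (by rw [hM₂, hN₂, h])
    exact acClass_eq_iff.1 (WithOne.coe_inj.1 (hM₃.trans hN₃.symm))

end NormalForms

/-! ### Separating irreducible terms in fields -/

section Separation

variable {L : DHLang} {X : DHSort → Type*} {F : Type} [Field F]

/-- The environment that gives every variable the value of its atom. -/
def atomEnv (v : Atom L X → Fˣ) : ∀ σ, X σ → DHStructure.fieldCarrier F σ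
  | .G, x => (v (atom (var x : DHTerm L X .G)) : F)
  | .E, x => (v (atom (var x : DHTerm L X .E)) : F)
  | .NZE, x => v (atom (var x : DHTerm L X .NZE))

/-- The value of a term when the values of terms `box a` are prescribed by `v`, independently of
the value of `a`. -/
def val (v : Atom L X → Fˣ) : {σ : DHSort} → DHTerm L X σ → DHStructure.fieldCarrier F σ
  | _, var x => atomEnv v _ x
  | _, gop a b => (a.val v + b.val v : F)
  | _, gid => (0 : F)
  | _, ginv a => (-a.val v : F)
  | _, exp a x => (a.val v * x.val v : F)
  | _, box h a => v (atom (box h a))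
  | _, add x y => (x.val v + y.val v : F)
  | _, zero => (0 : F)
  | _, neg x => (-x.val v : F)
  | _, mul x y => (x.val v * y.val v : F)
  | _, incl u => ((u.val v : Fˣ) : F)
  | _, one => (1 : Fˣ)
  | _, ninv u => ((u.val v)⁻¹ : Fˣ)
  | _, nmul u w => (u.val v * w.val v : Fˣ)

theorem val_nze (v : Atom L X → Fˣ) :
    ∀ u : DHTerm L X .NZE, u.val v = laurentMonomial v u.deg
  | var x => by rw [deg, laurentMonomial_single]; rfl
  | box h a => by rw [deg, laurentMonomial_single]; rfl
  | one => by rw [deg, laurentMonomial_zero]; rfl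
  | ninv u => by rw [deg, laurentMonomial_neg, ← val_nze v u]; rfl
  | nmul u w => by rw [deg, laurentMonomial_add, ← val_nze v u, ← val_nze v w]; rfl

theorem IsMonomial.val_eq (v : Atom L X → Fˣ) :
    ∀ {x : DHTerm L X .E}, IsMonomial x → x.val v = (laurentMonomial v x.deg : F)
  | var x, _ => by rw [deg, laurentMonomial_single]; rfl
  | incl u, _ => by rw [deg, ← val_nze]; rfl
  | mul x y, h => by
    rw [deg, laurentMonomial_add, Units.val_mul, ← (IsMonomial.of_mul h.irr).val_eq v,
      ← (IsMonomial.of_mul h.irr.mul_comm).val_eq v]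
    rfl
  | add x y, h => absurd rfl (h.ne_add x y)
  | zero, h => absurd rfl h.ne_zero
  | neg x, h => absurd rfl (h.ne_neg x)

theorem IsSummand.val_eq (v : Atom L X → Fˣ) {a : DHTerm L X .G} (h : IsSummand a) :
    a.val v = (laurentMonomial v a.deg : F) := by
  cases h with
  | var g => rw [deg, laurentMonomial_single]; rfl
  | @exp g x hx =>
    rw [deg, laurentMonomial_add, Units.val_mul, ← hx.val_eq, deg, laurentMonomial_single]
    rfl

theorem IsIrreducible.val_eq (v : Atom L X → Fˣ) :
    ∀ {s : DHTerm L X .G}, IsIrreducible s → s.val v = laurentEval v s.laurent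
  | var g, _ => by
    rw [laurent, laurentEval_single, (IsSummand.var g).val_eq, Int.cast_one, _root_.one_mul]
  | gop a b, h => by
    rw [laurent, laurentEval_add, ← ((isContext_gop_left b).isIrreducible h).val_eq v,
      ← ((isContext_gop_right a).isIrreducible h).val_eq v]
    rfl
  | gid, _ => by simp [laurent, laurentEval, val]
  | ginv a, h => by
    rw [laurent, laurentEval_neg, ← (isContext_ginv.isIrreducible h).val_eq v]
    rfl
  | exp a x, h => by
    rw [laurent, laurentEval_single, h.isSummand_exp.val_eq, Int.cast_one, _root_.one_mul]

/-- The terms to which `box` is applied somewhere in a term. -/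
def boxArgs : {σ : DHSort} → DHTerm L X σ → List (DHTerm L X .G)
  | _, var _ => []
  | _, gop a b => a.boxArgs ++ b.boxArgs
  | _, gid => []
  | _, ginv a => a.boxArgs
  | _, exp a x => a.boxArgs ++ x.boxArgs
  | _, box _ a => a :: a.boxArgs
  | _, add x y => x.boxArgs ++ y.boxArgs
  | _, zero => []
  | _, neg x => x.boxArgs
  | _, mul x y => x.boxArgs ++ y.boxArgs
  | _, incl u => u.boxArgs
  | _, one => []
  | _, ninv u => u.boxArgs
  | _, nmul u v => u.boxArgs ++ v.boxArgs

theorem IsIrreducible.of_mem_boxArgs {σ : DHSort} {s : DHTerm L X σ} (hs : IsIrreducible s)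
    {a : DHTerm L X .G} (ha : a ∈ s.boxArgs) : IsIrreducible a := by
  induction s with
  | var => simp [boxArgs] at ha
  | gid => simp [boxArgs] at ha
  | zero => simp [boxArgs] at ha
  | one => simp [boxArgs] at ha
  | gop b c ihb ihc =>
    exact (List.mem_append.1 ha).elim (ihb ((isContext_gop_left c).isIrreducible hs))
      (ihc ((isContext_gop_right b).isIrreducible hs))
  | ginv b ih => exact ih (isContext_ginv.isIrreducible hs) ha
  | exp b x ihb ihx =>
    exact (List.mem_append.1 ha).elim (ihb ((isContext_exp_left x).isIrreducible hs))
      (ihx ((isContext_exp_right b).isIrreducible hs))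
  | box h b ih =>
    have hb := (isContext_box h).isIrreducible hs
    rcases List.mem_cons.1 ha with rfl | ha
    · exact hb
    · exact ih hb ha
  | add x y ihx ihy =>
    exact (List.mem_append.1 ha).elim (ihx ((isContext_add_left y).isIrreducible hs))
      (ihy ((isContext_add_right x).isIrreducible hs))
  | neg x ih => exact ih (isContext_neg.isIrreducible hs) ha
  | mul x y ihx ihy =>
    exact (List.mem_append.1 ha).elim (ihx ((isContext_mul_left y).isIrreducible hs))
      (ihy ((isContext_mul_right x).isIrreducible hs))
  | incl u ih => exact ih (isContext_incl.isIrreducible hs) ha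
  | ninv u ih => exact ih (isContext_ninv.isIrreducible hs) ha
  | nmul u w ihu ihw =>
    exact (List.mem_append.1 ha).elim (ihu ((isContext_nmul_left w).isIrreducible hs))
      (ihw ((isContext_nmul_right u).isIrreducible hs))

/-- A box function that realizes the prescribed values of `box` evaluates terms as `val` does. -/
theorem eval_eq_val (b : L.HasBox → F → Fˣ) (v : Atom L X → Fˣ) {σ : DHSort} (s : DHTerm L X σ)
    (hb : ∀ (h : L.HasBox), ∀ a ∈ s.boxArgs, b h (a.val v) = v (atom (box h a))) :
    (DHStructure.ofField L F b).eval (atomEnv v) s = s.val v := by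
  induction s with
  | box h a ih =>
    rw [DHStructure.eval, ih fun h c hc => hb h c (List.mem_cons_of_mem _ hc)]
    exact hb h a List.mem_cons_self
  | _ => simp_all [DHStructure.eval, val, boxArgs]

/-- Irreducible terms that are not identical modulo associativity and commutativity are separated
in every field in which a suitable integer does not vanish.  The point is chosen such that the two
terms and all arguments of `box` in them take distinct values whenever they are not identical modulo
associativity and commutativity; then the prescribed values of `box` come from a function. -/
theorem IsIrreducible.exists_eval_ne {s t : DHTerm L X .G} (hs : IsIrreducible s)
    (ht : IsIrreducible t) (hst : ¬ ACEquiv s t) :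
    ∃ N : ℤ, N ≠ 0 ∧ ∀ (F : Type) [Field F], (N : F) ≠ 0 →
      ∃ b : L.HasBox → F → Fˣ, ¬ (DHStructure.ofField L F b).Satisfies s t := by
  classical
  let T : Finset (DHTerm L X .G) := (s :: t :: (s.boxArgs ++ t.boxArgs)).toFinset
  have hT : ∀ a ∈ T, IsIrreducible a := fun a ha => by
    simp only [T, List.mem_toFinset, List.mem_cons, List.mem_append] at ha
    rcases ha with rfl | rfl | ha | ha
    · exact hs
    · exact ht
    · exact hs.of_mem_boxArgs ha
    · exact ht.of_mem_boxArgs ha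
  obtain ⟨N, hN, H⟩ := exists_laurentEval_ne_zero
    ((T ×ˢ T).filter fun p => ¬ ACEquiv p.1 p.2) (fun p => p.1.laurent + -p.2.laurent)
    (fun p hp h => by
      obtain ⟨hp, hne⟩ := Finset.mem_filter.1 hp
      obtain ⟨h₁, h₂⟩ := Finset.mem_product.1 hp
      exact hne ((hT _ h₁).acEquiv_of_laurent_eq (hT _ h₂) (add_neg_eq_zero.1 h)))
  refine ⟨N, hN, fun F _ hNF => ?_⟩
  obtain ⟨v, hv⟩ := H F hNF
  have sep : ∀ a ∈ T, ∀ c ∈ T, (a.val v : F) = c.val v → ACEquiv a c := fun a ha c hc h => by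
    by_contra hne
    refine hv (a, c) (Finset.mem_filter.2 ⟨Finset.mem_product.2 ⟨ha, hc⟩, hne⟩) ?_
    rw [laurentEval_add, laurentEval_neg, ← (hT a ha).val_eq, ← (hT c hc).val_eq]
    exact add_neg_eq_zero.2 h
  let b : L.HasBox → F → Fˣ := fun h z =>
    if hz : ∃ a ∈ T, (a.val v : F) = z then v (atom (box h hz.choose)) else 1
  have hb : ∀ (h : L.HasBox), ∀ a ∈ T, b h (a.val v) = v (atom (box h a)) := fun h a ha => by
    have hz : ∃ c ∈ T, (c.val v : F) = a.val v := ⟨a, ha, rfl⟩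
    have : b h (a.val v) = v (atom (box h hz.choose)) := dif_pos hz
    rw [this, atom_eq_iff.2 ((isContext_box h).acEquiv
      (sep _ hz.choose_spec.1 a ha hz.choose_spec.2))]
  refine ⟨b, fun h => hst (sep s (by simp [T]) t (by simp [T]) ?_)⟩
  have h := h (atomEnv v)
  rwa [eval_eq_val b v s fun h a ha => hb h a (by simp [T, ha]),
    eval_eq_val b v t fun h a ha => hb h a (by simp [T, ha])] at h

theorem SameNormalForm.provable {s t : DHTerm L X .G} (h : SameNormalForm s t) :
    Provable s t := by
  obtain ⟨s', hs, hs'⟩ := exists_reduces_isIrreducible s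
  obtain ⟨t', ht, ht'⟩ := exists_reduces_isIrreducible t
  exact .trans hs.provable (.trans (h s' t' hs hs' ht ht').provable (.symm ht.provable))

/-- Suppose that for every nonzero integer `N` there is a field in which `N ≠ 0` and in which the
equation holds under all box functions.  Then the two sides have the same normal form: by soundness
the equation may be passed to irreducible reducts, and those are separated if they differ. -/
theorem sameNormalForm_of_satisfies {s t : DHTerm L X .G}
    (h : ∀ N : ℤ, N ≠ 0 → ∃ (F : Type) (_ : Field F), (N : F) ≠ 0 ∧
      ∀ b : L.HasBox → F → Fˣ, (DHStructure.ofField L F b).Satisfies s t) :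
    SameNormalForm s t := by
  intro s' t' hs hs' ht ht'
  by_contra hne
  obtain ⟨N, hN, H⟩ := hs'.exists_eval_ne ht' hne
  obtain ⟨F, _, hNF, hF⟩ := h N hN
  obtain ⟨b, hb⟩ := H F hNF
  exact hb fun η => ((hs.provable.eval_eq b η).symm.trans (hF b η)).trans (ht.provable.eval_eq b η)

end Separation

end DHTerm

/-! ### Prime fields, their ultraproducts, and the equivalences -/

theorem exists_nonPrincipal : ∃ D : Ultrafilter Nat.Primes, NonPrincipal D := by
  have : Infinite Nat.Primes := Nat.infinite_setOfPred_prime.to_subtype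
  refine ⟨Filter.hyperfilter Nat.Primes, fun q h => ?_⟩
  have hq : ({q} : Set Nat.Primes) ∈ Filter.hyperfilter Nat.Primes := by rw [h]; exact rfl
  exact (Set.finite_singleton q).notMem_hyperfilter hq

theorem exists_prime_intCast_ne_zero {N : ℤ} (hN : N ≠ 0) :
    ∃ q : ℕ, q.Prime ∧ (N : ZMod q) ≠ 0 := by
  obtain ⟨q, hq, hp⟩ := Nat.exists_infinite_primes (N.natAbs + 1)
  refine ⟨q, hp, fun h => ?_⟩
  have := Int.natAbs_dvd_natAbs.2 ((ZMod.intCast_zmod_eq_zero_iff_dvd N q).1 h)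
  have := Nat.le_of_dvd (Int.natAbs_pos.2 hN) this
  simp at this
  omega

/-- A nonprincipal ultraproduct of prime fields has characteristic zero, as a nonzero integer
vanishes in finitely many of the factors. -/
theorem NonPrincipal.intCast_ne_zero {D : Ultrafilter Nat.Primes} (hD : NonPrincipal D) {N : ℤ}
    (hN : N ≠ 0) : (N : PrimeUltraproduct D) ≠ 0 := by
  intro h
  have h' : ∀ᶠ q : Nat.Primes in (D : Filter Nat.Primes), ((N : ∀ q : Nat.Primes, ZMod q) q) = 0 :=
    (PrimeUltraproduct.coe_eq_coe D (N : ∀ q : Nat.Primes, ZMod q) 0).1 h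
  have hfin : {q : Nat.Primes | ((N : ∀ q : Nat.Primes, ZMod q) q) = 0}.Finite := by
    refine Set.Finite.of_injOn (f := fun q : Nat.Primes => (q : ℕ)) (t := Set.Iic N.natAbs)
      (fun q hq => ?_) (fun _ _ _ _ h => Subtype.ext h) (Set.finite_Iic _)
    have hq : ((N : ℤ) : ZMod q) = 0 := hq
    have := Int.natAbs_dvd_natAbs.2 ((ZMod.intCast_zmod_eq_zero_iff_dvd N q).1 hq)
    exact Nat.le_of_dvd (Int.natAbs_pos.2 hN) this
  obtain ⟨q, -, hq⟩ := Ultrafilter.eq_pure_of_finite_mem hfin h'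
  exact hD q hq

/-- The equivalences in either language, with box functions that are indexed by the proof that
`box` belongs to the signature. -/
theorem DHTerm.tfae_ofField {L : DHLang} {X : DHSort → Type*} (s t : DHTerm L X .G) :
    List.TFAE [
      DHTerm.Provable s t,
      ∀ (q : ℕ) [Fact q.Prime] (b : L.HasBox → ZMod q → (ZMod q)ˣ),
        (DHStructure.ofField L (ZMod q) b).Satisfies s t,
      ∀ D : Ultrafilter Nat.Primes, NonPrincipal D →
        ∀ b : L.HasBox → PrimeUltraproduct D → (PrimeUltraproduct D)ˣ,
          (DHStructure.ofField L (PrimeUltraproduct D) b).Satisfies s t,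
      ∃ D : Ultrafilter Nat.Primes, NonPrincipal D ∧
        ∀ b : L.HasBox → PrimeUltraproduct D → (PrimeUltraproduct D)ˣ,
          (DHStructure.ofField L (PrimeUltraproduct D) b).Satisfies s t,
      ∀ b : L.HasBox → ℚ → ℚˣ, (DHStructure.ofField L ℚ b).Satisfies s t,
      DHTerm.SameNormalForm s t] := by
  tfae_have 1 → 2 := fun h _ _ b => h.satisfies b
  tfae_have 1 → 3 := fun h _ _ b => h.satisfies b
  tfae_have 1 → 5 := fun h b => h.satisfies b
  tfae_have 3 → 4 := fun h => exists_nonPrincipal.imp fun D hD => ⟨hD, h D hD⟩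
  tfae_have 6 → 1 := DHTerm.SameNormalForm.provable
  tfae_have 2 → 6 := fun h => DHTerm.sameNormalForm_of_satisfies fun N hN => by
    obtain ⟨q, hq, hN⟩ := exists_prime_intCast_ne_zero hN
    have : Fact q.Prime := ⟨hq⟩
    exact ⟨ZMod q, inferInstance, hN, h q⟩
  tfae_have 4 → 6 := fun ⟨D, hD, h⟩ => DHTerm.sameNormalForm_of_satisfies fun N hN =>
    ⟨PrimeUltraproduct D, inferInstance, hD.intCast_ne_zero hN, h⟩
  tfae_have 5 → 6 := fun h => DHTerm.sameNormalForm_of_satisfies fun N hN =>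
    ⟨ℚ, inferInstance, Int.cast_ne_zero.2 hN, h⟩
  tfae_finish

/-- A box function for the language without `box` carries no information. -/
theorem DHStructure.forall_ofField_boxFree {F : Type} [Field F] {X : DHSort → Type*}
    {s t : DHTerm .boxFree X .G} :
    (∀ b : DHLang.boxFree.HasBox → F → Fˣ, (DHStructure.ofField .boxFree F b).Satisfies s t) ↔
      (DHStructure.withoutBox F).Satisfies s t :=
  ⟨fun h => h _, fun h b => by rwa [show b = fun h => h.elim from funext fun h => h.elim]⟩

/-- A box function for the full language is an arbitrary function. -/
theorem DHStructure.forall_ofField_full {F : Type} [Field F] {X : DHSort → Type*}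
    {s t : DHTerm .full X .G} :
    (∀ b : DHLang.full.HasBox → F → Fˣ, (DHStructure.ofField .full F b).Satisfies s t) ↔
      ∀ b : F → Fˣ, (DHStructure.withBox F b).Satisfies s t :=
  ⟨fun h b => h fun _ => b, fun h b => h (b trivial)⟩

/-- A derivation in the full language can be replaced by a `box`-free one, since the equation holds
in `M_ℚ` for an arbitrary choice of the box function. -/
theorem DHTerm.provable_toFull_iff {X : DHSort → Type*} {s t : DHTerm .boxFree X .G} :
    DHTerm.Provable s.toFull t.toFull ↔ DHTerm.Provable s t := by
  refine ⟨fun h => ?_, fun h => h.toFull⟩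
  refine ((DHTerm.tfae_ofField s t).out 0 4).2 (DHStructure.forall_ofField_boxFree.2 fun η => ?_)
  rw [← DHTerm.eval_toFull (fun _ => 1), ← DHTerm.eval_toFull (fun _ => 1)]
  exact h.eval_eq (fun _ _ => 1) η

theorem mainTheorem1 (X : DHSort → Type*) :
    (∀ s t : DHTerm .full X .G,
      List.TFAE [
        DHTerm.Provable s t,
        ∀ (q : ℕ) [Fact q.Prime] (b : ZMod q → (ZMod q)ˣ),
          (DHStructure.withBox (ZMod q) b).Satisfies s t,
        ∀ D : Ultrafilter Nat.Primes, NonPrincipal D →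
          ∀ b : PrimeUltraproduct D → (PrimeUltraproduct D)ˣ,
            (DHStructure.withBox (PrimeUltraproduct D) b).Satisfies s t,
        ∃ D : Ultrafilter Nat.Primes, NonPrincipal D ∧
          ∀ b : PrimeUltraproduct D → (PrimeUltraproduct D)ˣ,
            (DHStructure.withBox (PrimeUltraproduct D) b).Satisfies s t,
        ∀ b : ℚ → ℚˣ, (DHStructure.withBox ℚ b).Satisfies s t,
        DHTerm.SameNormalForm s t]) ∧
    (∀ s t : DHTerm .boxFree X .G,
      List.TFAE [
        DHTerm.Provable s.toFull t.toFull,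
        DHTerm.Provable s t,
        ∀ (q : ℕ) [Fact q.Prime], (DHStructure.withoutBox (ZMod q)).Satisfies s t,
        ∀ D : Ultrafilter Nat.Primes, NonPrincipal D →
          (DHStructure.withoutBox (PrimeUltraproduct D)).Satisfies s t,
        ∃ D : Ultrafilter Nat.Primes, NonPrincipal D ∧
          (DHStructure.withoutBox (PrimeUltraproduct D)).Satisfies s t,
        (DHStructure.withoutBox ℚ).Satisfies s t,
        DHTerm.SameNormalForm s t]) := by
  refine ⟨fun s t => ?_, fun s t => ?_⟩
  · have h := DHTerm.tfae_ofField s t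
    simpa only [DHStructure.forall_ofField_full] using h
  · have h := DHTerm.tfae_ofField s t
    simp only [DHStructure.forall_ofField_boxFree] at h
    rw [List.tfae_cons_cons]
    exact ⟨DHTerm.provable_toFull_iff, h⟩
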